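/- \textbf{Setting.} Infinite draughts is played on the dark squares $\{(x,y)\in\mathbb Z^2 : x+y \text{ even}\}$ of an infinite checkerboard, by Black and Red. A position consists of an arbitrary (possibly infinite) arrangement of pieces on the dark squares, each being a pawn or a king of one of the two players, at most one on each square, together with the player whose turn it is. A piece moves one step diagonally to an empty square; it captures by jumping diagonally over an enemy piece on an adjacent square to the square just beyond, if that is empty, and the captured piece is removed at once. Pawns move and jump only forward (upward for Black, downward for Red), kings in all four diagonal directions; there is no promotion. \emph{Forced jumps:} a player who can jump must jump. \emph{Forced iterated jumps:} on one turn the jumping piece must go on jumping as long as it can. \emph{Infinite jumps:} if a piece makes infinitely many jumps on one turn, then all the captured pieces and the jumping piece itself are removed from the board. A player who has no legal move on their turn loses; infinite play is a draw. The game value of a position for one of the players (the open player) is the ordinal defined by transfinite recursion as follows. It is $0$ if the opponent is to move and has no legal move. Otherwise, if the open player is to move and can move to a position that has a value, it is $\alpha+1$, where $\alpha$ is the smallest such value; if the opponent is to move and every legal move leads to a position that has a value, it is the supremum of these values. In all other cases the position has no value. \textbf{Theorem.} For each of the two players as the open player, every countable ordinal is the game value of some position in infinite draughts. Moreover, if $p$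 is a position such that every position reachable from $p$ by legal moves (including $p$) has at most countably many legal moves, and if $p$ has a game value, then this value is a countable ordinal. -/

import Mathlib

namespace Draughts

/-- The two players. -/
inductive Player
  | black
  | red
  deriving DecidableEq

/-- The opponent of a player. -/
def Player.other : Player → Player
  | .black => .red
  | .red => .black

/-- Black's forward direction is upward, Red's is downward. -/
def Player.forward : Player → ℤ
  | .black => 1
  | .red => -1

/-- The two types of pieces. -/
inductive Rank
  | pawn
  | king
  deriving DecidableEq

/-- A piece has an owner and a type. -/
structure Piece where
  owner : Player
  rank : Rank

/-- Squares of the infinite checkerboard, as (column, row). -/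
abbrev Square := ℤ × ℤ

/-- The dark squares, on which all play takes place. -/
def Square.IsDark (s : Square) : Prop := Even (s.1 + s.2)

/-- The content of each square: empty, or occupied by a piece. -/
abbrev Board := Square → Option Piece

/-- The directions `d` in which a piece may move or jump: a diagonal unit step, which has to
go forward in case of a pawn, and is arbitrary in case of a king. -/
def Piece.CanGo (a : Piece) (d : Square) : Prop :=
  (d.1 = 1 ∨ d.1 = -1) ∧ (d.2 = 1 ∨ d.2 = -1) ∧ (a.rank = .pawn → d.2 = a.owner.forward)

/-- The piece on `s` belongs to `c` and can make a non-jumping move in direction `d`. -/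
def Board.CanStep (b : Board) (c : Player) (s d : Square) : Prop :=
  ∃ a, b s = some a ∧ a.owner = c ∧ a.CanGo d ∧ b (s + d) = none

/-- The board after the piece on `s` has moved to the adjacent square `s + d`. -/
def Board.step (b : Board) (s d : Square) : Board :=
  Function.update (Function.update b s none) (s + d) (b s)

/-- The piece on `s` belongs to `c` and can jump in direction `d`, over an enemy piece on the
adjacent square, to the empty square just beyond. -/
def Board.CanJump (b : Board) (c : Player) (s d : Square) : Prop :=
  ∃ a, b s = some a ∧ a.owner = c ∧ a.CanGo d ∧
    (∃ e, b (s + d) = some e ∧ e.owner ≠ c) ∧ b (s + d + d) = none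

/-- The board after the piece on `s` has jumped in direction `d`; the captured piece is removed
immediately. -/
def Board.jump (b : Board) (s d : Square) : Board :=
  Function.update (Function.update (Function.update b s none) (s + d) none) (s + d + d) (b s)

/-- A single jump by player `c`, as a relation between the board together with the square of the
active piece, before and after the jump. -/
def JumpStep (c : Player) (x y : Board × Square) : Prop :=
  ∃ d, x.1.CanJump c x.2 d ∧ y = (x.1.jump x.2 d, x.2 + d + d)

/-- A finite iterated jump (of at least one jump) by one piece of player `c`, which is continued
until that piece cannot jump any more. -/
def FiniteJumpMove (c : Player) (b b' : Board) : Prop :=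
  ∃ s s', Relation.TransGen (JumpStep c) (b, s) (b', s') ∧ ∀ y, ¬ JumpStep c (b', s') y

/-- An infinite iterated jump by one piece of player `c`. The `n`-th jump is made on the board
`B n` from the square `s n` in the direction `d n`. All the captured pieces are removed from the
board, and so is the active piece; everything else is unchanged. -/
def InfiniteJumpMove (c : Player) (b b' : Board) : Prop :=
  ∃ (B : ℕ → Board) (s d : ℕ → Square),
    B 0 = b ∧
    (∀ n, (B n).CanJump c (s n) (d n) ∧ B (n + 1) = (B n).jump (s n) (d n) ∧
      s (n + 1) = s n + d n + d n) ∧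
    (∀ t, (t = s 0 ∨ ∃ n, t = s n + d n) → b' t = none) ∧
    (∀ t, ¬ (t = s 0 ∨ ∃ n, t = s n + d n) → b' t = b t)

/-- A non-jumping move by player `c`. -/
def SimpleMove (c : Player) (b b' : Board) : Prop :=
  ∃ s d, b.CanStep c s d ∧ b' = b.step s d

/-- Some piece of player `c` can jump. -/
def Board.HasJump (b : Board) (c : Player) : Prop := ∃ s d, b.CanJump c s d

/-- A position: any arrangement of (possibly infinitely many) pieces on the dark squares,
together with the player whose turn it is. -/
structure Position where
  board : Board
  turn : Player
  dark : ∀ s, board s ≠ none → Square.IsDark s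

/-- The legal moves, as a relation between positions, with forced jumps, forced iterated jumps,
and the infinite-jump rule. -/
def LegalMove (p q : Position) : Prop :=
  q.turn = p.turn.other ∧
    (FiniteJumpMove p.turn p.board q.board ∨
      InfiniteJumpMove p.turn p.board q.board ∨
      (¬ p.board.HasJump p.turn ∧ SimpleMove p.turn p.board q.board))

/-- The game is already won for player `o`: it is the opponent's turn, and the opponent has no
legal move. -/
def Position.WonFor (p : Position) (o : Player) : Prop :=
  p.turn = o.other ∧ ∀ q, ¬ LegalMove p q

/-- `HasGameValue o p α`: the position `p` has game value `α` with `o` as the open player.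
The value is `0` if `p` is already won for `o`. Otherwise, if it is the turn of `o`, it is `β + 1`
for the least `β` that is the value of a position to which `o` can move; and if it is the
opponent's turn, it is the supremum of the values of the positions to which a legal move can be
made, provided that all of these have a value. Thus positions need not have a value. The
recursion is on `α`, and for the same `α` the opponent's turn comes after the turn of `o`. -/
def HasGameValue (o : Player) (p : Position) (α : Ordinal.{0}) : Prop :=
  (p.WonFor o ∧ α = 0) ∨
  (¬ p.WonFor o ∧ p.turn = o ∧
    ∃ β, ∃ _ : β < α, α = β + 1 ∧
      (∃ q, LegalMove p q ∧ HasGameValue o q β) ∧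
      ∀ γ, ∀ _ : γ < β, ∀ q, LegalMove p q → ¬ HasGameValue o q γ) ∨
  (¬ p.WonFor o ∧ ∃ _ : p.turn = o.other,
    (∀ q, ∀ _ : LegalMove p q, ∃ β, ∃ _ : β ≤ α, HasGameValue o q β) ∧
    IsLUB {β | ∃ q, ∃ _ : LegalMove p q, ∃ _ : β ≤ α, HasGameValue o q β} α)
termination_by (α, if p.turn = o then 0 else 1)
decreasing_by
  · exact Prod.Lex.left _ _ ‹_›
  · exact Prod.Lex.left _ _ (lt_trans ‹_› ‹_›)
  all_goals
    rename_i h1 h2 h3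
    rcases lt_or_eq_of_le h3 with h | rfl
    · exact Prod.Lex.left _ _ h
    · have e1 := h2.1
      rw [h1] at e1
      apply Prod.Lex.right
      cases o <;> simp_all [Player.other]

end Draughts

namespace Draughts

/-! Upper bound: on the open player's turn a value is a successor, and on the opponent's turn it is
a supremum over countably many moves, so countability follows by induction
(`HasGameValue.countable`).

Existence: the values form an initial segment of the ordinals (`HasGameValue.exists_of_le`), so for
a countable α it is enough to find a position whose value exists and is at least α. A half turn of
the board with exchanged colours (`HasGameValue.flip`) reduces the problem to Black as the open
player.

The position, made of pawns only, encodes the tree of descending sequences of ordinals below α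
(`descentTree`). Each node owns a diagonal line of black pawns on alternate squares, along which a
red pawn at its top could jump forever. Lines of even nodes run down to the right, those of odd
nodes down to the left, and parents and children have opposite parity, so the line of a child
crosses that of its parent. Below the crossing sits a gadget, which lets the jumping pawn turn off.

Red's only active pawn must jump. If it jumps forever, it disappears; every other red pawn is
locked, so Black moves a spare pawn and Red has no move (`valueAtLeast_of_guarded`). If it turns off
into the gadget of a child, three forced captures follow: Black takes the arriving pawn with the
pawn on (-4, -6), a red guard jumps from (-6, -4) into the vacated square and thereby removes the
plug on (-5, -5) from the first landing square of the child's line, and Black takes the guard with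
the pawn on (-5, -7). Now the red pawn on (-3, -3), at the top of the child's line, is the only one
that can jump. `Stage` and `Ready` record the positions during and after this exchange. All this
activity moves downwards: whatever lies below is still in its initial state, and the other red pawns
stay locked in intact gadgets.

So Red in effect chooses a smaller label, and Black spends at least one move on each choice. By
induction the value at a node is at least its label (`valueAtLeast_of_ready`). -/

theorem Player.other_ne (o : Player) : o ≠ o.other := by cases o <;> simp [Player.other]

theorem Player.other_other (o : Player) : o.other.other = o := by cases o <;> rfl

theorem Player.eq_or_eq_other (c o : Player) : c = o ∨ c = o.other := by
  cases c <;> cases o <;> simp [Player.other]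

/-! ### Game values and lower bounds for them -/

theorem hasGameValue_of_turn_self {o : Player} {p : Position} (h : p.turn = o) (α : Ordinal.{0}) :
    HasGameValue o p α ↔ ∃ β, α = β + 1 ∧ (∃ q, LegalMove p q ∧ HasGameValue o q β) ∧
      ∀ γ < β, ∀ q, LegalMove p q → ¬ HasGameValue o q γ := by
  have hw : ¬ p.WonFor o := fun hw => o.other_ne (h.symm.trans hw.1)
  rw [HasGameValue]
  constructor
  · rintro (⟨h1, _⟩ | ⟨_, _, β, _, h2, h3, h4⟩ | ⟨_, h1, _⟩)
    · exact absurd h1 hw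
    · exact ⟨β, h2, h3, h4⟩
    · exact absurd (h.symm.trans h1) o.other_ne
  · rintro ⟨β, h2, h3, h4⟩
    exact Or.inr (Or.inl ⟨hw, h, β, by rw [h2]; exact lt_add_one β, h2, h3, h4⟩)

/-- The clause for won positions is absorbed, because the supremum of the empty set is 0. -/
theorem hasGameValue_of_turn_other {o : Player} {p : Position} (h : p.turn = o.other)
    (α : Ordinal.{0}) :
    HasGameValue o p α ↔ (∀ q, LegalMove p q → ∃ β ≤ α, HasGameValue o q β) ∧
      IsLUB {β | ∃ q, LegalMove p q ∧ β ≤ α ∧ HasGameValue o q β} α := by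
  rw [HasGameValue]
  constructor
  · rintro (⟨h1, rfl⟩ | ⟨_, h1, _⟩ | ⟨_, _, h2, h3⟩)
    · refine ⟨fun q hq => absurd hq (h1.2 q), ?_⟩
      rw [show (0 : Ordinal.{0}) = ⊥ from rfl]
      convert (isLUB_empty : IsLUB (∅ : Set Ordinal.{0}) ⊥)
      ext β
      simp only [Set.mem_ofPred_eq, Set.mem_empty_iff_false, iff_false]
      rintro ⟨q, hq, _⟩
      exact h1.2 q hq
    · exact absurd (h1.symm.trans h) o.other_ne
    · refine ⟨fun q hq => ?_, ?_⟩
      · obtain ⟨β, h4, h5⟩ := h2 q hq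
        exact ⟨β, h4, h5⟩
      · convert h3 using 2
        simp only [exists_prop]
  · rintro ⟨h2, h3⟩
    by_cases hw : p.WonFor o
    · refine Or.inl ⟨hw, ?_⟩
      have : {β | ∃ q, LegalMove p q ∧ β ≤ α ∧ HasGameValue o q β} = (∅ : Set Ordinal.{0}) := by
        ext β
        simp only [Set.mem_ofPred_eq, Set.mem_empty_iff_false, iff_false]
        rintro ⟨q, hq, _⟩
        exact hw.2 q hq
      rw [this] at h3
      exact h3.unique isLUB_empty
    · refine Or.inr (Or.inr ⟨hw, h, fun q hq => ?_, ?_⟩)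
      · obtain ⟨β, h4, h5⟩ := h2 q hq
        exact ⟨β, h4, h5⟩
      · convert h3 using 2
        simp only [exists_prop]

theorem LegalMove.turn_eq {o : Player} {p q : Position} (h : LegalMove p q)
    (hp : p.turn = o.other) : q.turn = o := by
  rw [h.1, hp, o.other_other]

/-- Minimality settles the open player's turn without induction. On the opponent's turn the two
sets, though cut off at α and at β, are then equal, and so are their least upper bounds. -/
theorem HasGameValue.unique {o : Player} {p : Position} {α β : Ordinal.{0}}
    (h₁ : HasGameValue o p α) (h₂ : HasGameValue o p β) : α = β := by
  have self : ∀ {p : Position} {α β : Ordinal.{0}}, p.turn = o →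
      HasGameValue o p α → HasGameValue o p β → α = β := by
    intro p α β hp h₁ h₂
    rw [hasGameValue_of_turn_self hp] at h₁ h₂
    obtain ⟨γ, rfl, ⟨q, hq, hqv⟩, hm⟩ := h₁
    obtain ⟨δ, rfl, ⟨r, hr, hrv⟩, hn⟩ := h₂
    rcases lt_trichotomy γ δ with h | rfl | h
    · exact absurd hqv (hn γ h q hq)
    · rfl
    · exact absurd hrv (hm δ h r hr)
  rcases p.turn.eq_or_eq_other o with hp | hp
  · exact self hp h₁ h₂
  · rw [hasGameValue_of_turn_other hp] at h₁ h₂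
    have : {γ | ∃ q, LegalMove p q ∧ γ ≤ α ∧ HasGameValue o q γ} =
        {γ | ∃ q, LegalMove p q ∧ γ ≤ β ∧ HasGameValue o q γ} := by
      ext γ
      constructor
      · rintro ⟨q, hq, _, h⟩
        obtain ⟨δ, hδ, h'⟩ := h₂.1 q hq
        exact ⟨q, hq, self (hq.turn_eq hp) h' h ▸ hδ, h⟩
      · rintro ⟨q, hq, _, h⟩
        obtain ⟨δ, hδ, h'⟩ := h₁.1 q hq
        exact ⟨q, hq, self (hq.turn_eq hp) h' h ▸ hδ, h⟩
    rw [this] at h₁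
    exact h₁.2.unique h₂.2

/-- The position has a game value, which is at least `α`. -/
def ValueAtLeast (o : Player) (p : Position) (α : Ordinal.{0}) : Prop :=
  ∃ β, α ≤ β ∧ HasGameValue o p β

theorem ValueAtLeast.mono {o : Player} {p : Position} {α β : Ordinal.{0}}
    (h : ValueAtLeast o p β) (hle : α ≤ β) : ValueAtLeast o p α := by
  obtain ⟨γ, h1, h2⟩ := h
  exact ⟨γ, hle.trans h1, h2⟩

theorem ValueAtLeast.le {o : Player} {p : Position} {α β : Ordinal.{0}}
    (h : ValueAtLeast o p α) (h' : HasGameValue o p β) : α ≤ β := by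
  obtain ⟨γ, h1, h2⟩ := h
  exact h2.unique h' ▸ h1

theorem ValueAtLeast.exists_of_turn_self {o : Player} {p q : Position} (hp : p.turn = o)
    (hq : LegalMove p q) (h : ValueAtLeast o q 0) :
    ∃ β, (∃ q, LegalMove p q ∧ HasGameValue o q β) ∧ HasGameValue o p (β + 1) := by
  obtain ⟨β, _, hβ⟩ := h
  let S : Set Ordinal.{0} := {β | ∃ q, LegalMove p q ∧ HasGameValue o q β}
  have hS : S.Nonempty := ⟨β, q, hq, hβ⟩
  have hmem : sInf S ∈ S := csInf_mem hS
  refine ⟨sInf S, hmem, ?_⟩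
  rw [hasGameValue_of_turn_self hp]
  exact ⟨sInf S, rfl, hmem, fun γ hγ r hr hv => notMem_of_lt_csInf' hγ ⟨r, hr, hv⟩⟩

theorem ValueAtLeast.of_turn_self_zero {o : Player} {p q : Position} (hp : p.turn = o)
    (hq : LegalMove p q) (h : ValueAtLeast o q 0) : ValueAtLeast o p 0 := by
  obtain ⟨β, _, h⟩ := exists_of_turn_self hp hq h
  exact ⟨_, bot_le, h⟩

/-- The value uses the least successor, so the bound is needed for every move; the single move `q`
only ensures that a value exists. -/
theorem ValueAtLeast.of_turn_self {o : Player} {p q : Position} {α : Ordinal.{0}} (hp : p.turn = o)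
    (hq : LegalMove p q) (h : ∀ r, LegalMove p r → ValueAtLeast o r α) :
    ValueAtLeast o p (α + 1) := by
  obtain ⟨β, ⟨r, hr, hv⟩, h'⟩ := exists_of_turn_self hp hq ((h q hq).mono bot_le)
  exact ⟨_, by gcongr; exact (h r hr).le hv, h'⟩

/-- Asking for successors of value at least `β + 1` for all `β < α` treats zero, successor and limit
ordinals alike. -/
theorem ValueAtLeast.of_turn_other {o : Player} {p : Position} {α : Ordinal.{0}}
    (hp : p.turn = o.other) (h : ∀ r, LegalMove p r → ValueAtLeast o r 0)
    (hα : ∀ β < α, ∃ r, LegalMove p r ∧ ValueAtLeast o r (β + 1)) :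
    ValueAtLeast o p α := by
  choose f _ hf using fun r : {r // LegalMove p r} => h r.1 r.2
  have hb : BddAbove (Set.range f) := Ordinal.bddAbove_of_small
  have hlub : IsLUB (Set.range f) (sSup (Set.range f)) := by
    -- Without legal moves the range is empty and its supremum is 0, the value of a won position.
    rcases isEmpty_or_nonempty {r // LegalMove p r} with he | he
    · rw [Set.range_eq_empty]
      rw [csSup_empty]
      exact isLUB_empty
    · exact isLUB_csSup (Set.range_nonempty f) hb
  refine ⟨sSup (Set.range f), ?_, ?_⟩
  · refine le_of_forall_lt fun β hβ => ?_
    obtain ⟨r, hr, hv⟩ := hα β hβ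
    exact lt_of_lt_of_le (lt_add_one β)
      ((hv.le (hf ⟨r, hr⟩)).trans (hlub.1 (Set.mem_range_self _)))
  · rw [hasGameValue_of_turn_other hp]
    refine ⟨fun q hq => ⟨f ⟨q, hq⟩, hlub.1 (Set.mem_range_self _), hf ⟨q, hq⟩⟩, ?_⟩
    convert hlub
    ext β
    constructor
    · rintro ⟨q, hq, _, hv⟩
      exact ⟨⟨q, hq⟩, (hf ⟨q, hq⟩).unique hv⟩
    · rintro ⟨⟨q, hq⟩, rfl⟩
      exact ⟨q, hq, hlub.1 (Set.mem_range_self _), hf ⟨q, hq⟩⟩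

theorem ValueAtLeast.of_turn_other_of_forall {o : Player} {p q : Position} {α : Ordinal.{0}}
    (hp : p.turn = o.other) (hq : LegalMove p q) (h : ∀ r, LegalMove p r → ValueAtLeast o r α) :
    ValueAtLeast o p α := by
  obtain ⟨γ, h1, h2⟩ := of_turn_other (α := 0) hp (fun r hr => (h r hr).mono bot_le)
    (fun β hβ => absurd hβ not_lt_bot)
  refine ⟨γ, ?_, h2⟩
  rw [hasGameValue_of_turn_other hp] at h2
  obtain ⟨δ, h3, h4⟩ := h2.1 q hq
  exact ((h q hq).le h4).trans h3

/-- Every ordinal below the value of a position is the value of a position. -/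
theorem HasGameValue.exists_of_le {o : Player} (α : Ordinal.{0}) :
    ∀ p, HasGameValue o p α → ∀ β ≤ α, ∃ q, HasGameValue o q β := by
  induction α using WellFoundedLT.induction with
  | ind α ih =>
    -- A move of the opponent may lead to a position of the same value α, out of reach of the
    -- induction hypothesis. The open player's turn, where the ordinal does drop, is therefore
    -- settled beforehand up to and including α.
    have self : ∀ p γ, p.turn = o → γ ≤ α → HasGameValue o p γ → ∀ β < γ,
        ∃ q, HasGameValue o q β := by
      intro p γ hp hγ h β hβ
      rw [hasGameValue_of_turn_self hp] at h
      obtain ⟨δ, rfl, ⟨q, _, hq⟩, _⟩ := h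
      exact ih δ ((lt_add_one δ).trans_le hγ) q hq β (Order.lt_add_one_iff.1 hβ)
    intro p h β hβ
    rcases hβ.eq_or_lt with rfl | hβ
    · exact ⟨p, h⟩
    rcases p.turn.eq_or_eq_other o with hp | hp
    · exact self p α hp le_rfl h β hβ
    · rw [hasGameValue_of_turn_other hp] at h
      obtain ⟨γ, ⟨q, hq, hγ, hv⟩, hlt⟩ := (lt_isLUB_iff h.2).1 hβ
      exact self q γ (hq.turn_eq hp) hγ hv β hlt

/-! ### Countability of values -/

theorem card_le_aleph0_iff (α : Ordinal.{0}) :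
    α.card ≤ Cardinal.aleph0 ↔ (Set.Iio α).Countable := by
  rw [← Cardinal.le_aleph0_iff_set_countable, Cardinal.mk_Iio_ordinal, Cardinal.lift_le_aleph0]

/-- The initial segment below a supremum is the union of the initial segments below its members:
countably many moves, with at most one value each. -/
theorem HasGameValue.countable {o : Player} (α : Ordinal.{0}) :
    ∀ p, (∀ q, Relation.ReflTransGen LegalMove p q → {r | LegalMove q r}.Countable) →
      HasGameValue o p α → (Set.Iio α).Countable := by
  induction α using WellFoundedLT.induction with
  | ind α ih =>
    have self : ∀ p γ, p.turn = o → γ ≤ α →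
        (∀ q, Relation.ReflTransGen LegalMove p q → {r | LegalMove q r}.Countable) →
        HasGameValue o p γ → (Set.Iio γ).Countable := by
      intro p γ hp hγ hc h
      rw [hasGameValue_of_turn_self hp] at h
      obtain ⟨δ, rfl, ⟨q, hq, hqv⟩, _⟩ := h
      have := ih δ ((lt_add_one δ).trans_le hγ) q
        (fun r hr => hc r (Relation.ReflTransGen.head hq hr)) hqv
      refine (this.union (Set.countable_singleton δ)).mono fun x hx => ?_
      rcases (Order.lt_add_one_iff.1 (Set.mem_Iio.1 hx)).lt_or_eq with h | h
      · exact Or.inl h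
      · exact Or.inr h
    intro p hc h
    rcases p.turn.eq_or_eq_other o with hp | hp
    · exact self p α hp le_rfl hc h
    · rw [hasGameValue_of_turn_other hp] at h
      have hsub : Set.Iio α ⊆ ⋃ q ∈ {q | LegalMove p q}, ⋃ β ∈ {β | β ≤ α ∧ HasGameValue o q β},
          Set.Iio β := by
        intro x hx
        obtain ⟨γ, ⟨q, hq, hγ, hv⟩, hlt⟩ := (lt_isLUB_iff h.2).1 hx
        simp only [Set.mem_iUnion]
        exact ⟨q, hq, γ, ⟨hγ, hv⟩, hlt⟩
      refine Set.Countable.mono hsub ((hc p .refl).biUnion fun q hq => ?_)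
      refine Set.Countable.biUnion ?_ fun β hβ => self q β (hq.turn_eq hp) hβ.1
        (fun r hr => hc r (Relation.ReflTransGen.head hq hr)) hβ.2
      exact Set.Subsingleton.countable fun x hx y hy => hx.2.unique hy.2

/-! ### Boards of pawns, reflected frames and locked pawns -/

/-- A black pawn. -/
abbrev blackPawn : Piece := ⟨.black, .pawn⟩

/-- A red pawn. -/
abbrev redPawn : Piece := ⟨.red, .pawn⟩

/-- All pieces on the board are pawns. -/
def Board.PawnsOnly (b : Board) : Prop :=
  ∀ s, b s = none ∨ b s = some blackPawn ∨ b s = some redPawn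

theorem Board.jump_apply (b : Board) (s d t : Square) :
    b.jump s d t = if t = s + d + d then b s else if t = s + d then none
      else if t = s then none else b t := by
  simp only [Board.jump, Function.update_apply]

theorem Board.step_apply (b : Board) (s d t : Square) :
    b.step s d t = if t = s + d then b s else if t = s then none else b t := by
  simp only [Board.step, Function.update_apply]

theorem Board.PawnsOnly.jump {b : Board} (hb : b.PawnsOnly) (s d : Square) :
    (b.jump s d).PawnsOnly := by
  intro t
  rw [Board.jump_apply]
  split_ifs
  · exact hb s
  · exact Or.inl rfl
  · exact Or.inl rfl
  · exact hb t

theorem Board.PawnsOnly.canJump_red_iff {b : Board} (hb : b.PawnsOnly) (s d : Square) :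
    b.CanJump .red s d ↔ (d.1 = 1 ∨ d.1 = -1) ∧ d.2 = -1 ∧ b s = some redPawn ∧
      b (s + d) = some blackPawn ∧ b (s + d + d) = none := by
  constructor
  · rintro ⟨a, h1, h2, ⟨h3, h4, h5⟩, ⟨e, h6, h7⟩, h8⟩
    rcases hb s with h | h | h
    · simp [h] at h1
    · rw [h] at h1
      cases h1
      cases h2
    · rw [h] at h1
      cases h1
      refine ⟨h3, h5 rfl, h, ?_, h8⟩
      rcases hb (s + d) with h | h | h
      · simp [h] at h6
      · exact h
      · rw [h] at h6
        cases h6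
        exact absurd rfl h7
  · rintro ⟨h1, h2, h3, h4, h5⟩
    exact ⟨redPawn, h3, rfl, ⟨h1, Or.inr h2, fun _ => h2⟩, ⟨blackPawn, h4, by simp⟩, h5⟩

theorem Board.PawnsOnly.canJump_black_iff {b : Board} (hb : b.PawnsOnly) (s d : Square) :
    b.CanJump .black s d ↔ (d.1 = 1 ∨ d.1 = -1) ∧ d.2 = 1 ∧ b s = some blackPawn ∧
      b (s + d) = some redPawn ∧ b (s + d + d) = none := by
  constructor
  · rintro ⟨a, h1, h2, ⟨h3, h4, h5⟩, ⟨e, h6, h7⟩, h8⟩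
    rcases hb s with h | h | h
    · simp [h] at h1
    · rw [h] at h1
      cases h1
      refine ⟨h3, h5 rfl, h, ?_, h8⟩
      rcases hb (s + d) with h | h | h
      · simp [h] at h6
      · rw [h] at h6
        cases h6
        exact absurd rfl h7
      · exact h
    · rw [h] at h1
      cases h1
      cases h2
  · rintro ⟨h1, h2, h3, h4, h5⟩
    exact ⟨blackPawn, h3, rfl, ⟨h1, Or.inl h2, fun _ => h2⟩, ⟨redPawn, h4, by simp⟩, h5⟩

/-- The square with coordinates `(x, y)` in the frame with origin `o`, reflected in the vertical
direction through `o` if `σ = -1`. -/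
def place (o : Square) (σ x y : ℤ) : Square := (o.1 + σ * x, o.2 + y)

theorem place_inj {o : Square} {σ : ℤ} (hσ : σ = 1 ∨ σ = -1) {x y x' y' : ℤ} :
    place o σ x y = place o σ x' y' ↔ x = x' ∧ y = y' := by
  simp only [place, Prod.mk.injEq]
  rcases hσ with rfl | rfl <;> omega

theorem place_add (o : Square) (σ x y ε δ : ℤ) :
    place o σ x y + (σ * ε, δ) = place o σ (x + ε) (y + δ) := by
  simp only [place, Prod.mk_add_mk, Prod.mk.injEq]
  constructor <;> ring

theorem exists_place (o : Square) {σ : ℤ} (hσ : σ = 1 ∨ σ = -1) (s : Square) :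
    ∃ x y, s = place o σ x y := by
  refine ⟨σ * (s.1 - o.1), s.2 - o.2, ?_⟩
  rcases hσ with rfl | rfl <;> ext <;> simp [place]

theorem exists_eq_mul {σ e : ℤ} (hσ : σ = 1 ∨ σ = -1) (he : e = 1 ∨ e = -1) :
    ∃ ε, (ε = 1 ∨ ε = -1) ∧ e = σ * ε := by
  rcases hσ with rfl | rfl <;> rcases he with rfl | rfl <;> simp

theorem Board.PawnsOnly.canJump_red_place {b : Board} (hb : b.PawnsOnly) {o : Square} {σ : ℤ}
    (hσ : σ = 1 ∨ σ = -1) {x y : ℤ} {d : Square} (h : b.CanJump .red (place o σ x y) d) :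
    ∃ ε, (ε = 1 ∨ ε = -1) ∧ d = (σ * ε, -1) ∧ b (place o σ x y) = some redPawn ∧
      b (place o σ (x + ε) (y + -1)) = some blackPawn ∧
      b (place o σ (x + ε + ε) (y + -1 + -1)) = none := by
  obtain ⟨h1, h2, h3, h4, h5⟩ := (hb.canJump_red_iff _ _).1 h
  obtain ⟨ε, hε, he⟩ := exists_eq_mul hσ h1
  have hd : d = (σ * ε, -1) := Prod.ext he h2
  subst hd
  rw [place_add] at h4 h5
  rw [place_add] at h5
  exact ⟨ε, hε, rfl, h3, h4, h5⟩

theorem Board.PawnsOnly.canJump_red_of_place {b : Board} (hb : b.PawnsOnly) {o : Square} {σ : ℤ}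
    (hσ : σ = 1 ∨ σ = -1) {x y ε : ℤ} (hε : ε = 1 ∨ ε = -1)
    (h1 : b (place o σ x y) = some redPawn)
    (h2 : b (place o σ (x + ε) (y + -1)) = some blackPawn)
    (h3 : b (place o σ (x + ε + ε) (y + -1 + -1)) = none) :
    b.CanJump .red (place o σ x y) (σ * ε, -1) := by
  rw [hb.canJump_red_iff, place_add, place_add]
  refine ⟨?_, rfl, h1, h2, h3⟩
  rcases hσ with rfl | rfl <;> rcases hε with rfl | rfl <;> simp

theorem Board.PawnsOnly.canJump_black_place {b : Board} (hb : b.PawnsOnly) {o : Square} {σ : ℤ}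
    (hσ : σ = 1 ∨ σ = -1) {x y : ℤ} {s d : Square} (h : b.CanJump .black s d)
    (hs : s + d = place o σ x y) :
    ∃ ε, (ε = 1 ∨ ε = -1) ∧ d = (σ * ε, 1) ∧ s = place o σ (x - ε) (y - 1) ∧
      b (place o σ (x - ε) (y - 1)) = some blackPawn ∧
      b (place o σ (x + ε) (y + 1)) = none := by
  obtain ⟨h1, h2, h3, h4, h5⟩ := (hb.canJump_black_iff _ _).1 h
  obtain ⟨ε, hε, he⟩ := exists_eq_mul hσ h1
  have hd : d = (σ * ε, 1) := Prod.ext he h2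
  subst hd
  have hs' : s = place o σ (x - ε) (y - 1) := by
    have := place_add o σ (x - ε) (y - 1) ε 1
    rw [sub_add_cancel, sub_add_cancel, ← hs] at this
    exact (add_right_cancel this).symm
  rw [hs, place_add] at h5
  exact ⟨ε, hε, rfl, hs', hs' ▸ h3, h5⟩

theorem Board.PawnsOnly.canJump_black_of_place {b : Board} (hb : b.PawnsOnly) {o : Square} {σ : ℤ}
    (hσ : σ = 1 ∨ σ = -1) {x y ε : ℤ} (hε : ε = 1 ∨ ε = -1)
    (h1 : b (place o σ x y) = some blackPawn)
    (h2 : b (place o σ (x + ε) (y + 1)) = some redPawn)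
    (h3 : b (place o σ (x + ε + ε) (y + 1 + 1)) = none) :
    b.CanJump .black (place o σ x y) (σ * ε, 1) := by
  rw [hb.canJump_black_iff, place_add, place_add]
  refine ⟨?_, rfl, h1, h2, h3⟩
  rcases hσ with rfl | rfl <;> rcases hε with rfl | rfl <;> simp

theorem Board.PawnsOnly.canJump_black_from_place {b : Board} (hb : b.PawnsOnly) {o : Square}
    {σ : ℤ} (hσ : σ = 1 ∨ σ = -1) {x y : ℤ} {d : Square}
    (h : b.CanJump .black (place o σ x y) d) :
    ∃ ε, (ε = 1 ∨ ε = -1) ∧ b (place o σ (x + ε) (y + 1)) = some redPawn ∧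
      b (place o σ (x + ε + ε) (y + 1 + 1)) = none := by
  obtain ⟨h1, h2, h3, h4, h5⟩ := (hb.canJump_black_iff _ _).1 h
  obtain ⟨ε, hε, he⟩ := exists_eq_mul hσ h1
  have hd : d = (σ * ε, 1) := Prod.ext he h2
  subst hd
  rw [place_add] at h4 h5
  rw [place_add] at h5
  exact ⟨ε, hε, h4, h5⟩

theorem Board.jump_place (b : Board) {o : Square} {σ : ℤ} (hσ : σ = 1 ∨ σ = -1)
    (x y ε δ x' y' : ℤ) :
    b.jump (place o σ x y) (σ * ε, δ) (place o σ x' y') =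
      if x' = x + ε + ε ∧ y' = y + δ + δ then b (place o σ x y)
      else if x' = x + ε ∧ y' = y + δ then none
      else if x' = x ∧ y' = y then none else b (place o σ x' y') := by
  simp only [Board.jump_apply, place_add, place_inj hσ]

/-- A red pawn that can neither move nor be captured by black pawns. -/
def Board.Locked (b : Board) (s : Square) : Prop :=
  b s = some redPawn ∧ ∀ ε : ℤ, ε = 1 ∨ ε = -1 → b (s + (ε, -1)) = some blackPawn ∧
    b (s + (ε, -1) + (ε, -1)) ≠ none ∧ b (s + (-ε, 1)) ≠ none

theorem Board.Locked.not_canJump {b : Board} (hb : b.PawnsOnly) {s : Square} (h : b.Locked s)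
    (d : Square) : ¬ b.CanJump .red s d := by
  rw [hb.canJump_red_iff]
  rintro ⟨h1, h2, _, _, h5⟩
  obtain ⟨_, h6, _⟩ := h.2 d.1 h1
  rw [← h2] at h6
  exact h6 h5

theorem Board.Locked.not_captured {b : Board} (hb : b.PawnsOnly) {s d : Square}
    (h : b.Locked (s + d)) : ¬ b.CanJump .black s d := by
  rw [hb.canJump_black_iff]
  rintro ⟨h1, h2, _, _, h5⟩
  obtain ⟨_, _, h6⟩ := h.2 (-d.1) (by omega)
  rw [neg_neg, ← h2] at h6
  exact h6 h5

theorem Board.Locked.not_canStep {b : Board} {s : Square} (h : b.Locked s) (d : Square) :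
    ¬ b.CanStep .red s d := by
  rintro ⟨a, h1, h2, ⟨h3, _, h4⟩, h5⟩
  rw [h.1] at h1
  cases h1
  have hd := h4 rfl
  obtain ⟨h6, _⟩ := h.2 d.1 h3
  rw [show (d.1, (-1 : ℤ)) = d from Prod.ext rfl hd.symm, h5] at h6
  cases h6

theorem locked_place {b : Board} {o : Square} {σ : ℤ} (hσ : σ = 1 ∨ σ = -1) {x y : ℤ}
    (h : b (place o σ x y) = some redPawn)
    (h' : ∀ ε : ℤ, ε = 1 ∨ ε = -1 → b (place o σ (x + ε) (y + -1)) = some blackPawn ∧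
      b (place o σ (x + ε + ε) (y + -1 + -1)) ≠ none ∧ b (place o σ (x + -ε) (y + 1)) ≠ none) :
    b.Locked (place o σ x y) := by
  refine ⟨h, fun e he => ?_⟩
  obtain ⟨ε, hε, rfl⟩ := exists_eq_mul hσ he
  rw [← mul_neg, place_add, place_add, place_add]
  exact h' ε hε

/-! ### Constructing and recognising legal moves -/

theorem JumpStep.dark {c : Player} {x y : Board × Square} (h : JumpStep c x y)
    (hx : ∀ s, x.1 s ≠ none → s.IsDark) : ∀ s, y.1 s ≠ none → s.IsDark := by
  obtain ⟨d, ⟨a, h1, _, ⟨h2, h3, _⟩, _⟩, rfl⟩ := h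
  intro s hs
  dsimp only at hs
  rw [Board.jump_apply] at hs
  split_ifs at hs with h4 h5 h6
  · subst h4
    have := hx _ hs
    unfold Square.IsDark at *
    obtain ⟨k, hk⟩ := this
    refine ⟨k + d.1 + d.2, ?_⟩
    simp only [Prod.fst_add, Prod.snd_add]
    omega
  · exact absurd rfl hs
  · exact absurd rfl hs
  · exact hx s hs

theorem exists_position_of_transGen {c : Player} {x y : Board × Square}
    (h : Relation.TransGen (JumpStep c) x y) (hx : ∀ s, x.1 s ≠ none → s.IsDark) :
    ∃ p : Position, p.board = y.1 ∧ p.turn = c.other := by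
  have : ∀ s, y.1 s ≠ none → s.IsDark := by
    induction h with
    | single h => exact h.dark hx
    | tail _ h ih => exact h.dark ih
  exact ⟨⟨y.1, c.other, this⟩, rfl, rfl⟩

theorem exists_legalMove_of_transGen {p : Position} {b : Board} {s t : Square}
    (h : Relation.TransGen (JumpStep p.turn) (p.board, s) (b, t))
    (hlast : ∀ y, ¬ JumpStep p.turn (b, t) y) : ∃ q, LegalMove p q ∧ q.board = b := by
  obtain ⟨q, h1, h2⟩ := exists_position_of_transGen h p.dark
  exact ⟨q, ⟨h2, Or.inl ⟨s, t, by rw [h1]; exact ⟨h, hlast⟩⟩⟩, h1⟩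

theorem exists_legalMove_of_canJump {p : Position} {s d : Square} (h : p.board.CanJump p.turn s d)
    (hlast : ∀ d', ¬ (p.board.jump s d).CanJump p.turn (s + d + d) d') :
    ∃ q, LegalMove p q ∧ q.board = p.board.jump s d :=
  exists_legalMove_of_transGen (.single ⟨d, h, rfl⟩) (fun _ ⟨d', h', _⟩ => hlast d' h')

/-- A unique available jump that cannot be continued is forced: iterated and infinite jumps would
need a second jump, and simple moves are forbidden. -/
theorem LegalMove.eq_jump {p q : Position} {s d : Square} (h : LegalMove p q)
    (hj : p.board.CanJump p.turn s d)
    (huniq : ∀ s' d', p.board.CanJump p.turn s' d' → s' = s ∧ d' = d)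
    (hlast : ∀ d', ¬ (p.board.jump s d).CanJump p.turn (s + d + d) d') :
    q.board = p.board.jump s d := by
  rcases h.2 with ⟨s₀, s₁, h1, _⟩ | ⟨B, S, D, h0, h1, _⟩ | ⟨h1, _⟩
  · rcases (Relation.TransGen.head'_iff).1 h1 with ⟨y, ⟨d₀, h2, rfl⟩, h3⟩
    obtain ⟨rfl, rfl⟩ := huniq _ _ h2
    rcases Relation.ReflTransGen.cases_head h3 with h4 | ⟨z, ⟨d', h4, _⟩, _⟩
    · exact (congrArg Prod.fst h4).symm
    · exact absurd h4 (hlast d')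
  · obtain ⟨h2, h3, h4⟩ := h1 0
    rw [h0] at h2 h3
    obtain ⟨h5, h6⟩ := huniq _ _ h2
    rw [h5, h6] at h3 h4
    obtain ⟨h7, _⟩ := h1 1
    rw [h3, h4] at h7
    exact absurd h7 (hlast _)
  · exact absurd ⟨s, d, hj⟩ h1

/-! ### Exchange of the players -/

/-- The piece of the other player with the same rank. -/
def Piece.flip (a : Piece) : Piece := ⟨a.owner.other, a.rank⟩

/-- The board turned by 180 degrees, with the colours exchanged. -/
def Board.flip (b : Board) : Board := fun s => (b (-s)).map Piece.flip

/-- The position turned by 180 degrees, with the players exchanged. -/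
def Position.flip (p : Position) : Position where
  board := p.board.flip
  turn := p.turn.other
  dark s hs := by
    have h : p.board (-s) ≠ none := fun h => hs (by simp [Board.flip, h])
    have := p.dark _ h
    simp only [Square.IsDark, Prod.fst_neg, Prod.snd_neg] at this ⊢
    rwa [← neg_add, even_neg] at this

theorem Piece.flip_flip (a : Piece) : a.flip.flip = a := by
  cases a
  simp [Piece.flip, Player.other_other]

theorem Board.flip_flip (b : Board) : b.flip.flip = b := by
  funext s
  simp only [Board.flip, neg_neg, Option.map_map]
  convert Option.map_id_apply
  funext a
  exact a.flip_flip

theorem Position.flip_flip (p : Position) : p.flip.flip = p := by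
  cases p
  simp only [Position.flip, Board.flip_flip, Player.other_other]

theorem Board.flip_neg (b : Board) (s : Square) : b.flip (-s) = (b s).map Piece.flip := by
  simp [Board.flip]

theorem Board.flip_eq_none {b : Board} {s : Square} : b.flip s = none ↔ b (-s) = none := by
  simp [Board.flip]

theorem Piece.CanGo.flip {a : Piece} {d : Square} (h : a.CanGo d) : a.flip.CanGo (-d) := by
  obtain ⟨h1, h2, h3⟩ := h
  refine ⟨?_, ?_, fun hr => ?_⟩
  · simp only [Prod.fst_neg]; omega
  · simp only [Prod.snd_neg]; omega
  · have := h3 hr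
    simp only [Prod.snd_neg, this, Piece.flip]
    cases a.owner <;> simp [Player.other, Player.forward]

theorem Player.other_injective : Function.Injective Player.other := by
  intro a b
  cases a <;> cases b <;> simp [Player.other]

theorem Board.CanStep.flip {b : Board} {c : Player} {s d : Square} (h : b.CanStep c s d) :
    b.flip.CanStep c.other (-s) (-d) := by
  obtain ⟨a, h1, rfl, h2, h3⟩ := h
  refine ⟨a.flip, ?_, rfl, h2.flip, ?_⟩
  · rw [Board.flip_neg, h1]; rfl
  · rw [← neg_add, Board.flip_neg, h3]; rfl

theorem Board.CanJump.flip {b : Board} {c : Player} {s d : Square} (h : b.CanJump c s d) :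
    b.flip.CanJump c.other (-s) (-d) := by
  obtain ⟨a, h1, rfl, h2, ⟨e, h3, h4⟩, h5⟩ := h
  refine ⟨a.flip, ?_, rfl, h2.flip, ⟨e.flip, ?_, fun he => h4 (Player.other_injective he)⟩, ?_⟩
  · rw [Board.flip_neg, h1]; rfl
  · rw [← neg_add, Board.flip_neg, h3]; rfl
  · rw [← neg_add, ← neg_add, Board.flip_neg, h5]; rfl

theorem Board.flip_step (b : Board) (s d : Square) :
    (b.step s d).flip = b.flip.step (-s) (-d) := by
  funext t
  simp only [Board.flip, Board.step_apply, neg_neg, ← neg_add, neg_eq_iff_eq_neg]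
  split_ifs <;> rfl

theorem Board.flip_jump (b : Board) (s d : Square) :
    (b.jump s d).flip = b.flip.jump (-s) (-d) := by
  funext t
  simp only [Board.flip, Board.jump_apply, neg_neg, ← neg_add, neg_eq_iff_eq_neg]
  split_ifs <;> rfl

theorem JumpStep.flip {c : Player} {x y : Board × Square} (h : JumpStep c x y) :
    JumpStep c.other (x.1.flip, -x.2) (y.1.flip, -y.2) := by
  obtain ⟨d, h1, rfl⟩ := h
  refine ⟨-d, h1.flip, ?_⟩
  simp only [Board.flip_jump, neg_add]

theorem JumpStep.of_flip {c : Player} {b : Board} {s : Square} {y : Board × Square}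
    (h : JumpStep c.other (b.flip, -s) y) : JumpStep c (b, s) (y.1.flip, -y.2) := by
  have := h.flip
  simpa only [Player.other_other, Board.flip_flip, neg_neg] using this

theorem LegalMove.flip {p q : Position} (h : LegalMove p q) : LegalMove p.flip q.flip := by
  obtain ⟨h0, h⟩ := h
  refine ⟨congrArg Player.other h0, ?_⟩
  rcases h with ⟨s, t, h1, h2⟩ | ⟨B, S, D, h1, h2, h3, h4⟩ | ⟨h1, s, d, h2, h3⟩
  · refine Or.inl ⟨-s, -t, ?_, fun y hy => h2 _ hy.of_flip⟩
    exact h1.lift (fun x : Board × Square => (x.1.flip, -x.2))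
      (fun _ _ (h : JumpStep _ _ _) => h.flip)
  · refine Or.inr (Or.inl ⟨fun n => (B n).flip, fun n => -S n, fun n => -D n, congrArg Board.flip h1,
      fun n => ⟨(h2 n).1.flip, ?_, ?_⟩, fun t ht => ?_, fun t ht => ?_⟩)
    · exact (congrArg Board.flip (h2 n).2.1).trans (Board.flip_jump _ _ _)
    · exact (congrArg Neg.neg (h2 n).2.2).trans (by simp only [neg_add])
    · refine Board.flip_eq_none.2 (h3 _ ?_)
      rcases ht with rfl | ⟨n, rfl⟩
      · left; rw [neg_neg]
      · right; exact ⟨n, by simp only [neg_add, neg_neg]⟩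
    · refine congrArg (Option.map Piece.flip) (h4 (-t) fun ht' => ht ?_)
      rcases ht' with h | ⟨n, h⟩
      · left; exact neg_eq_iff_eq_neg.1 h
      · right
        refine ⟨n, ?_⟩
        rw [← neg_add, ← h, neg_neg]
  · refine Or.inr (Or.inr ⟨?_, -s, -d, h2.flip, ?_⟩)
    · rintro ⟨t, e, h⟩
      have := h.flip
      simp only [Position.flip, Player.other_other, Board.flip_flip] at this
      exact h1 ⟨_, _, this⟩
    · simp only [Position.flip, h3, Board.flip_step]

theorem LegalMove.of_flip {p q : Position} (h : LegalMove p.flip q) : LegalMove p q.flip := by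
  have := h.flip
  rwa [Position.flip_flip] at this

theorem HasGameValue.flip (α : Ordinal.{0}) : ∀ o p, HasGameValue o p α →
    HasGameValue o.other p.flip α := by
  induction α using WellFoundedLT.induction with
  | ind α ih =>
    have self : ∀ o p, ∀ γ ≤ α, p.turn = o → HasGameValue o p γ →
        HasGameValue o.other p.flip γ := by
      intro o p γ hγ hp h
      rw [hasGameValue_of_turn_self hp] at h
      rw [hasGameValue_of_turn_self (p := p.flip) (congrArg Player.other hp)]
      obtain ⟨β, rfl, ⟨q, hq, hv⟩, hm⟩ := h
      have hβ := (lt_add_one β).trans_le hγ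
      refine ⟨β, rfl, ⟨q.flip, hq.flip, ih β hβ o q hv⟩, fun δ hδ r hr hv' => ?_⟩
      refine hm δ hδ r.flip hr.of_flip ?_
      have := ih δ (hδ.trans hβ) _ _ hv'
      rwa [Player.other_other] at this
    intro o p h
    rcases p.turn.eq_or_eq_other o with hp | hp
    · exact self o p α le_rfl hp h
    · rw [hasGameValue_of_turn_other hp] at h
      rw [hasGameValue_of_turn_other (p := p.flip) (congrArg Player.other hp)]
      have hback : ∀ r, LegalMove p.flip r → ∀ β ≤ α, HasGameValue o.other r β →
          HasGameValue o r.flip β := by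
        intro r hr β hβ hv
        have ht : r.turn = o.other := by
          have := hr.of_flip.turn_eq hp
          rw [← this]
          exact (Player.other_other _).symm
        have := self _ _ β hβ ht hv
        rwa [Player.other_other] at this
      refine ⟨fun q hq => ?_, ?_⟩
      · obtain ⟨β, hβ, hv⟩ := h.1 _ hq.of_flip
        refine ⟨β, hβ, ?_⟩
        have := self _ _ β hβ (hq.of_flip.turn_eq hp) hv
        rwa [Position.flip_flip] at this
      · convert h.2 using 1
        ext β
        constructor
        · rintro ⟨q, hq, hβ, hv⟩
          exact ⟨q.flip, hq.of_flip, hβ, hback q hq β hβ hv⟩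
        · rintro ⟨q, hq, hβ, hv⟩
          exact ⟨q.flip, hq.flip, hβ, self o q β hβ (hq.turn_eq hp) hv⟩

/-! ### Iterated jumps along a line with turn-offs -/

/-- In the given frame, a red pawn on the origin is the only red piece that can jump. It can jump
forever in the direction `(1, -1)` along a line of black pawns. At the squares with first
coordinate in `J` it may instead turn off, which ends after two jumps in direction `(-1, -1)`. -/
structure Track (b : Board) (o : Square) (σ : ℤ) (J : Set ℤ) : Prop where
  sign : σ = 1 ∨ σ = -1
  pawns : b.PawnsOnly
  start : b (place o σ 0 0) = some redPawn
  others : ∀ s d, b.CanJump .red s d → s = place o σ 0 0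
  dot : ∀ x y : ℤ, x % 2 = 1 → 0 ≤ x → x + y = 0 → b (place o σ x y) = some blackPawn
  landing : ∀ x y : ℤ, x % 2 = 0 → 0 < x → x + y = 0 → b (place o σ x y) = none
  side : ∀ x : ℤ, x % 2 = 0 → 0 ≤ x → x ∉ J → ∀ y, x + y = 0 →
    b (place o σ (x + -1) (y + -1)) = some blackPawn →
      b (place o σ (x + -1 + -1) (y + -1 + -1)) ≠ none
  exit_dot : ∀ x ∈ J, ∀ y, x + y = 0 → b (place o σ (x + -1) (y + -1)) = some blackPawn
  exit_landing : ∀ x ∈ J, ∀ u v, u = x - 2 → v = -x - 2 → b (place o σ u v) = none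
  exit_side : ∀ x ∈ J, ∀ u v, u = x - 1 → v = -x - 3 → b (place o σ u v) = none
  exit_dot' : ∀ x ∈ J, ∀ u v, u = x - 3 → v = -x - 3 → b (place o σ u v) = some blackPawn
  exit_landing' : ∀ x ∈ J, ∀ u v, u = x - 4 → v = -x - 4 → b (place o σ u v) = none
  exit_side' : ∀ x ∈ J, ∀ u v, u = x - 3 → v = -x - 5 → b (place o σ u v) = none
  exit_end : ∀ x ∈ J, ∀ u v, u = x - 6 → v = -x - 6 → b (place o σ u v) ≠ none

/-- The board after `n` jumps along the track. -/
def trail (b : Board) (o : Square) (σ : ℤ) : ℕ → Board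
  | 0 => b
  | n + 1 => (trail b o σ n).jump (place o σ (2 * n) (-(2 * n))) (σ * 1, -1)

/-- The board after `n` jumps along the track, and one jump in direction `(-1, -1)`. -/
def turnOff (b : Board) (o : Square) (σ : ℤ) (n : ℕ) : Board :=
  (trail b o σ n).jump (place o σ (2 * n) (-(2 * n))) (σ * -1, -1)

/-- The board after `n` jumps along the track, and two jumps in direction `(-1, -1)`. -/
def exitBoard (b : Board) (o : Square) (σ : ℤ) (n : ℕ) : Board :=
  (turnOff b o σ n).jump (place o σ (2 * n + -1 + -1) (-(2 * n) + -1 + -1)) (σ * -1, -1)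

theorem trail_apply (b : Board) (o : Square) {σ : ℤ} (hσ : σ = 1 ∨ σ = -1) (n : ℕ) (x y : ℤ) :
    trail b o σ n (place o σ x y) = if x = 2 * n ∧ y = -(2 * n) then b (place o σ 0 0)
      else if x + y = 0 ∧ 0 ≤ x ∧ x < 2 * n then none else b (place o σ x y) := by
  induction n generalizing x y with
  | zero =>
    simp only [trail, Nat.cast_zero, mul_zero, neg_zero]
    split_ifs with h1 h2
    · rw [h1.1, h1.2]
    · omega
    · rfl
  | succ n ih =>
    simp only [trail, Board.jump_place _ hσ, ih, Nat.cast_succ, and_self, if_true]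
    split_ifs <;> first | rfl | omega

theorem turnOff_apply (b : Board) (o : Square) {σ : ℤ} (hσ : σ = 1 ∨ σ = -1) (n : ℕ) (x y : ℤ) :
    turnOff b o σ n (place o σ x y) =
      if x = 2 * n - 2 ∧ y = -(2 * n) - 2 then b (place o σ 0 0)
      else if x + y = 0 ∧ 0 ≤ x ∧ x ≤ 2 * n ∨ x = 2 * n - 1 ∧ y = -(2 * n) - 1 then none
      else b (place o σ x y) := by
  simp only [turnOff, Board.jump_place _ hσ, trail_apply b o hσ, and_self, if_true]
  split_ifs <;> first | rfl | omega

theorem exitBoard_apply (b : Board) (o : Square) {σ : ℤ} (hσ : σ = 1 ∨ σ = -1) (n : ℕ) (x y : ℤ) :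
    exitBoard b o σ n (place o σ x y) =
      if x = 2 * n - 4 ∧ y = -(2 * n) - 4 then b (place o σ 0 0)
      else if x + y = 0 ∧ 0 ≤ x ∧ x ≤ 2 * n ∨ x = 2 * n - 1 ∧ y = -(2 * n) - 1 ∨
        x = 2 * n - 2 ∧ y = -(2 * n) - 2 ∨ x = 2 * n - 3 ∧ y = -(2 * n) - 3 then none
      else b (place o σ x y) := by
  simp only [exitBoard, Board.jump_place _ hσ, turnOff_apply b o hσ]
  split_ifs <;> first | rfl | omega

theorem Board.PawnsOnly.trail {b : Board} (hb : b.PawnsOnly) (o : Square) (σ : ℤ) (n : ℕ) :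
    (trail b o σ n).PawnsOnly := by
  induction n with
  | zero => exact hb
  | succ n ih => exact ih.jump _ _

namespace Track

variable {b : Board} {o : Square} {σ : ℤ} {J : Set ℤ}

theorem canJump_trail (h : Track b o σ J) (n : ℕ) :
    (trail b o σ n).CanJump .red (place o σ (2 * n) (-(2 * n))) (σ * 1, -1) := by
  refine (h.pawns.trail o σ n).canJump_red_of_place h.sign (Or.inl rfl) ?_ ?_ ?_
  · rw [trail_apply _ _ h.sign, if_pos ⟨rfl, rfl⟩, h.start]
  · rw [trail_apply _ _ h.sign, if_neg (by omega), if_neg (by omega)]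
    exact h.dot _ _ (by omega) (by omega) (by omega)
  · rw [trail_apply _ _ h.sign, if_neg (by omega), if_neg (by omega)]
    exact h.landing _ _ (by omega) (by omega) (by omega)

theorem of_canJump_trail (h : Track b o σ J) (n : ℕ) {d : Square}
    (hd : (trail b o σ n).CanJump .red (place o σ (2 * n) (-(2 * n))) d) :
    d = (σ * 1, -1) ∨ (2 * n : ℤ) ∈ J ∧ d = (σ * -1, -1) := by
  obtain ⟨ε, hε, rfl, _, h2, h3⟩ := (h.pawns.trail o σ n).canJump_red_place h.sign hd
  rcases hε with rfl | rfl
  · exact Or.inl rfl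
  · refine Or.inr ⟨?_, rfl⟩
    by_contra hJ
    rw [trail_apply _ _ h.sign, if_neg (by omega), if_neg (by omega)] at h2 h3
    exact h.side _ (by omega) (by omega) hJ _ (by omega) h2 h3

theorem canJump_turnOff (h : Track b o σ J) {n : ℕ} (hn : (2 * n : ℤ) ∈ J) :
    (trail b o σ n).CanJump .red (place o σ (2 * n) (-(2 * n))) (σ * -1, -1) := by
  refine (h.pawns.trail o σ n).canJump_red_of_place h.sign (Or.inr rfl) ?_ ?_ ?_
  · rw [trail_apply _ _ h.sign, if_pos ⟨rfl, rfl⟩, h.start]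
  · rw [trail_apply _ _ h.sign, if_neg (by omega), if_neg (by omega)]
    exact h.exit_dot _ hn _ (by omega)
  · rw [trail_apply _ _ h.sign, if_neg (by omega), if_neg (by omega)]
    exact h.exit_landing _ hn _ _ (by omega) (by omega)

theorem pawns_turnOff (h : Track b o σ J) (n : ℕ) : (turnOff b o σ n).PawnsOnly :=
  (h.pawns.trail o σ n).jump _ _

theorem pawns_exitBoard (h : Track b o σ J) (n : ℕ) : (exitBoard b o σ n).PawnsOnly :=
  (h.pawns_turnOff n).jump _ _

theorem canJump_exitBoard (h : Track b o σ J) {n : ℕ} (hn : (2 * n : ℤ) ∈ J) :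
    (turnOff b o σ n).CanJump .red (place o σ (2 * n + -1 + -1) (-(2 * n) + -1 + -1))
      (σ * -1, -1) := by
  refine (h.pawns_turnOff n).canJump_red_of_place h.sign (Or.inr rfl) ?_ ?_ ?_
  · rw [turnOff_apply _ _ h.sign, if_pos (by omega), h.start]
  · rw [turnOff_apply _ _ h.sign, if_neg (by omega), if_neg (by omega)]
    exact h.exit_dot' _ hn _ _ (by omega) (by omega)
  · rw [turnOff_apply _ _ h.sign, if_neg (by omega), if_neg (by omega)]
    exact h.exit_landing' _ hn _ _ (by omega) (by omega)

theorem of_canJump_turnOff (h : Track b o σ J) {n : ℕ} (hn : (2 * n : ℤ) ∈ J) {d : Square}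
    (hd : (turnOff b o σ n).CanJump .red
      (place o σ (2 * n + -1 + -1) (-(2 * n) + -1 + -1)) d) : d = (σ * -1, -1) := by
  obtain ⟨ε, hε, rfl, _, h2, h3⟩ := (h.pawns_turnOff n).canJump_red_place h.sign hd
  rcases hε with rfl | rfl
  · rw [turnOff_apply _ _ h.sign, if_neg (by omega), if_neg (by omega),
      h.exit_side _ hn _ _ (by omega) (by omega)] at h2
    cases h2
  · rfl

theorem not_canJump_exitBoard (h : Track b o σ J) {n : ℕ} (hn : (2 * n : ℤ) ∈ J) (d : Square) :
    ¬ (exitBoard b o σ n).CanJump .red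
      (place o σ (2 * n + -1 + -1 + -1 + -1) (-(2 * n) + -1 + -1 + -1 + -1)) d := by
  intro hd
  obtain ⟨ε, hε, rfl, _, h2, h3⟩ := (h.pawns_exitBoard n).canJump_red_place h.sign hd
  rcases hε with rfl | rfl
  · rw [exitBoard_apply _ _ h.sign, if_neg (by omega), if_neg (by omega),
      h.exit_side' _ hn _ _ (by omega) (by omega)] at h2
    cases h2
  · rw [exitBoard_apply _ _ h.sign, if_neg (by omega), if_neg (by omega)] at h3
    exact h.exit_end _ hn _ _ (by omega) (by omega) h3

/-- The states that occur in an iterated jump along the track. -/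
def State (b : Board) (o : Square) (σ : ℤ) (J : Set ℤ) (x : Board × Square) : Prop :=
  (∃ n : ℕ, x = (trail b o σ n, place o σ (2 * n) (-(2 * n)))) ∨
  (∃ n : ℕ, (2 * n : ℤ) ∈ J ∧
    x = (turnOff b o σ n, place o σ (2 * n + -1 + -1) (-(2 * n) + -1 + -1))) ∨
  (∃ n : ℕ, (2 * n : ℤ) ∈ J ∧ x = (exitBoard b o σ n,
    place o σ (2 * n + -1 + -1 + -1 + -1) (-(2 * n) + -1 + -1 + -1 + -1)))

theorem jumpStep_trail (h : Track b o σ J) (n : ℕ) :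
    JumpStep .red (trail b o σ n, place o σ (2 * n) (-(2 * n)))
      (trail b o σ (n + 1), place o σ (2 * (n + 1 : ℕ)) (-(2 * (n + 1 : ℕ)))) := by
  refine ⟨_, h.canJump_trail n, ?_⟩
  simp only [place_add]
  refine Prod.ext rfl ((place_inj h.sign).2 ⟨?_, ?_⟩) <;> push_cast <;> ring

theorem jumpStep_turnOff (h : Track b o σ J) {n : ℕ} (hn : (2 * n : ℤ) ∈ J) :
    JumpStep .red (trail b o σ n, place o σ (2 * n) (-(2 * n)))
      (turnOff b o σ n, place o σ (2 * n + -1 + -1) (-(2 * n) + -1 + -1)) := by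
  refine ⟨_, h.canJump_turnOff hn, ?_⟩
  simp only [place_add]
  rfl

theorem jumpStep_exitBoard (h : Track b o σ J) {n : ℕ} (hn : (2 * n : ℤ) ∈ J) :
    JumpStep .red (turnOff b o σ n, place o σ (2 * n + -1 + -1) (-(2 * n) + -1 + -1))
      (exitBoard b o σ n, place o σ (2 * n + -1 + -1 + -1 + -1)
        (-(2 * n) + -1 + -1 + -1 + -1)) := by
  refine ⟨_, h.canJump_exitBoard hn, ?_⟩
  simp only [place_add]
  rfl

theorem state_of_jumpStep (h : Track b o σ J) {x y : Board × Square} (hx : State b o σ J x)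
    (hxy : JumpStep .red x y) : State b o σ J y := by
  rcases hx with ⟨n, rfl⟩ | ⟨n, hn, rfl⟩ | ⟨n, hn, rfl⟩
  · obtain ⟨d, hd, rfl⟩ := hxy
    rcases h.of_canJump_trail n hd with rfl | ⟨hn, rfl⟩
    · refine Or.inl ⟨n + 1, ?_⟩
      simp only [place_add]
      refine Prod.ext rfl ((place_inj h.sign).2 ⟨?_, ?_⟩) <;> push_cast <;> ring
    · refine Or.inr (Or.inl ⟨n, hn, ?_⟩)
      simp only [place_add]
      rfl
  · obtain ⟨d, hd, rfl⟩ := hxy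
    cases h.of_canJump_turnOff hn hd
    refine Or.inr (Or.inr ⟨n, hn, ?_⟩)
    simp only [place_add]
    rfl
  · obtain ⟨d, hd, rfl⟩ := hxy
    exact absurd hd (h.not_canJump_exitBoard hn d)

theorem transGen_trail (h : Track b o σ J) (n : ℕ) :
    Relation.ReflTransGen (JumpStep .red) (b, place o σ 0 0)
      (trail b o σ n, place o σ (2 * n) (-(2 * n))) := by
  induction n with
  | zero => simpa [trail] using Relation.ReflTransGen.refl
  | succ n ih => exact ih.tail (h.jumpStep_trail n)

theorem exists_legalMove {p : Position} (hp : p.turn = .red) (h : Track p.board o σ J) {n : ℕ}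
    (hn : (2 * n : ℤ) ∈ J) : ∃ q, LegalMove p q ∧ q.board = exitBoard p.board o σ n := by
  have h1 := ((h.transGen_trail n).tail (h.jumpStep_turnOff hn))
  refine exists_legalMove_of_transGen (s := place o σ 0 0)
    (t := place o σ (2 * n + -1 + -1 + -1 + -1) (-(2 * n) + -1 + -1 + -1 + -1)) ?_ ?_
  · rw [hp]
    exact Relation.TransGen.tail' h1 (h.jumpStep_exitBoard hn)
  · rw [hp]
    rintro y ⟨d, hd, _⟩
    exact h.not_canJump_exitBoard hn d hd

/-- Turning off ends after two jumps, so an infinite jump can never do it. -/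
theorem infinite_eq_trail (h : Track b o σ J) {B : ℕ → Board} {s d : ℕ → Square}
    (h0 : B 0 = b) (hB : ∀ n, (B n).CanJump .red (s n) (d n) ∧ B (n + 1) = (B n).jump (s n) (d n) ∧
      s (n + 1) = s n + d n + d n) (n : ℕ) :
    B n = trail b o σ n ∧ s n = place o σ (2 * n) (-(2 * n)) := by
  have hstep : ∀ n, JumpStep .red (B n, s n) (B (n + 1), s (n + 1)) := fun n =>
    ⟨d n, (hB n).1, Prod.ext (hB n).2.1 (hB n).2.2⟩
  induction n with
  | zero =>
    refine ⟨h0, ?_⟩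
    have := (hB 0).1
    rw [h0] at this
    simpa using h.others _ _ this
  | succ n ih =>
    have h1 := (hB n).1
    rw [ih.1, ih.2] at h1
    rcases h.of_canJump_trail n h1 with hd | ⟨hn, hd⟩
    · rw [(hB n).2.1, (hB n).2.2, ih.1, ih.2, hd, place_add, place_add]
      refine ⟨rfl, (place_inj h.sign).2 ⟨?_, ?_⟩⟩ <;> push_cast <;> ring
    · exfalso
      have h2 : B (n + 1) = turnOff b o σ n := by
        rw [(hB n).2.1, ih.1, ih.2, hd]
        rfl
      have h3 : s (n + 1) = place o σ (2 * n + -1 + -1) (-(2 * n) + -1 + -1) := by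
        rw [(hB n).2.2, ih.2, hd, place_add, place_add]
      have h4 := (hB (n + 1)).1
      rw [h2, h3] at h4
      have hd' := h.of_canJump_turnOff hn h4
      have h5 : B (n + 2) = exitBoard b o σ n := by
        rw [(hB (n + 1)).2.1, h2, h3, hd']
        rfl
      have h6 : s (n + 2) =
          place o σ (2 * n + -1 + -1 + -1 + -1) (-(2 * n) + -1 + -1 + -1 + -1) := by
        rw [(hB (n + 1)).2.2, h3, hd', place_add, place_add]
      have h7 := (hB (n + 2)).1
      rw [h5, h6] at h7
      exact h.not_canJump_exitBoard hn _ h7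

/-- On the line the pawn can always go on, and after one sideways jump it can make the second; so a
completed finite jump has turned off and made both sideways jumps. -/
theorem of_legalMove {p q : Position} (hp : p.turn = .red) (h : Track p.board o σ J)
    (hq : LegalMove p q) :
    (∃ n : ℕ, (2 * n : ℤ) ∈ J ∧ q.board = exitBoard p.board o σ n) ∨
      ∀ x y, q.board (place o σ x y) =
        if x + y = 0 ∧ 0 ≤ x ∧ (x = 0 ∨ x % 2 = 1) then none else p.board (place o σ x y) := by
  rcases hq.2 with ⟨s, t, h1, h2⟩ | ⟨B, s, d, h0, h1, h2, h3⟩ | ⟨h1, _⟩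
  · rw [hp] at h1 h2
    left
    obtain ⟨_, ⟨d, hd, _⟩, _⟩ := (Relation.TransGen.head'_iff).1 h1
    cases h.others _ _ hd
    have hs : State p.board o σ J (q.board, t) := by
      have h4 : State p.board o σ J (p.board, place o σ 0 0) := Or.inl ⟨0, by simp [trail]⟩
      generalize (q.board, t) = y at h1
      clear h2
      induction h1 with
      | single h5 => exact h.state_of_jumpStep h4 h5
      | tail _ h5 ih => exact h.state_of_jumpStep ih h5
    rcases hs with ⟨n, hn⟩ | ⟨n, hJ, hn⟩ | ⟨n, hJ, hn⟩
    · rw [hn] at h2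
      exact absurd (h.jumpStep_trail n) (h2 _)
    · rw [hn] at h2
      exact absurd (h.jumpStep_exitBoard hJ) (h2 _)
    · exact ⟨n, hJ, congrArg Prod.fst hn⟩
  · right
    rw [hp] at h1
    have hs := h.infinite_eq_trail h0 h1
    have hd : ∀ n, s n + d n = place o σ (2 * n + 1) (-(2 * n) + -1) := by
      intro n
      have h4 := (h1 n).1
      rw [(hs n).1, (hs n).2] at h4
      rcases h.of_canJump_trail n h4 with hd | ⟨_, hd⟩
      · rw [(hs n).2, hd, place_add]
      -- Turning off here would give the next square first coordinate `2 * n - 2` instead of `2 * n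
      -- + 2`.
      · have h5 := (h1 n).2.2
        rw [(hs n).2, (hs (n + 1)).2, hd, place_add, place_add, place_inj h.sign] at h5
        omega
    intro x y
    split_ifs with hxy
    · apply h2
      obtain ⟨h4, h5, h6 | h6⟩ := hxy
      · left
        rw [(hs 0).2, place_inj h.sign]
        push_cast
        omega
      · right
        -- The pawn with odd coordinate `x = 2 * n + 1` is captured by the jump with index `n = x /
        -- 2`.
        refine ⟨(x / 2).toNat, ?_⟩
        rw [hd, place_inj h.sign]
        omega
    · apply h3
      rintro (h4 | ⟨n, h4⟩)
      · rw [(hs 0).2, place_inj h.sign] at h4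
        push_cast at h4
        omega
      · rw [hd, place_inj h.sign] at h4
        omega
  · refine absurd ⟨place o σ 0 0, (σ * 1, -1), ?_⟩ h1
    have := h.canJump_trail 0
    rw [hp]
    simpa [trail] using this

end Track

/-! ### The layout of the tree on the board -/

/-- A tree on a set of natural numbers with root `0`, such that parents are smaller than their
children and have the opposite parity. -/
structure NatTree where
  par : ℕ → ℕ
  node : Set ℕ
  zero_mem : 0 ∈ node
  par_zero : par 0 = 0
  par_lt : ∀ m ∈ node, m ≠ 0 → par m < m
  parity : ∀ m ∈ node, m ≠ 0 → (m + par m) % 2 = 1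

/-- The sign that tells whether the line of a node runs down to the right or to the left. -/
def sg (k : ℕ) : ℤ := if k % 2 = 0 then 1 else -1

theorem sg_eq (k : ℕ) : sg k = 1 ∨ sg k = -1 := by
  unfold sg
  split_ifs <;> simp

theorem sg_cases (k : ℕ) : (k : ℤ) % 2 = 0 ∧ sg k = 1 ∨ (k : ℤ) % 2 = 1 ∧ sg k = -1 := by
  unfold sg
  split_ifs <;> omega

/-- The region around the crossing of the lines of a node and its parent that is occupied by their
gadget. -/
def Zone (x y : ℤ) : Prop := -14 ≤ x + y ∧ x + y ≤ -2 ∧ -4 ≤ x - y ∧ x - y ≤ 4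

/-- The squares occupied by black pawns in a gadget. -/
def blackSquares : List (ℤ × ℤ) :=
  [(0, -2), (-2, -4), (-4, -6), (-5, -7), (-5, -5), (-4, -4), (-7, -3), (-5, -3), (-7, -5),
    (-8, -6), (-4, -2), (-2, -2), (-1, -5), (-6, -8), (-5, -9)]

theorem zone_of_mem_blackSquares {q : ℤ × ℤ} (hq : q ∈ blackSquares) : Zone q.1 q.2 := by
  revert q
  unfold Zone
  decide

theorem diagonal_of_mem_blackSquares {q : ℤ × ℤ} (hq : q ∈ blackSquares) (h : q.1 = q.2) :
    -5 ≤ q.1 ∧ q.1 ≠ -3 := by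
  revert q
  decide

namespace NatTree

variable (T : NatTree)

/-- The square with coordinates `(x, y)` relative to the crossing of the lines of the node `m`
and its parent, in the frame in which the line of the parent runs down to the right. -/
def gadget (m : ℕ) (x y : ℤ) : Square :=
  place (sg (T.par m) * (16 * (m - T.par m)), -(16 * (m + T.par m))) (sg (T.par m)) x y

/-- The square with coordinates `(x, y)` relative to the starting square of the line of the node
`k`, in the frame in which this line runs down to the right. -/
def line (k : ℕ) (x y : ℤ) : Square :=
  place (sg k * (3 - 16 * (k - T.par k)), -3 - 16 * (k + T.par k)) (sg k) x y

theorem gadget_eq_line_par (m : ℕ) (x y : ℤ) :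
    T.gadget m x y = T.line (T.par m) (16 * (m - T.par (T.par m)) - 3 + x)
      (-(16 * (m - T.par (T.par m)) - 3) + y) := by
  simp only [gadget, line, place, Prod.mk.injEq]
  constructor <;> ring

variable {T}

theorem sg_eq_neg {m : ℕ} (hm : m ∈ T.node) (h0 : m ≠ 0) : sg m = -sg (T.par m) := by
  have := T.parity m hm h0
  unfold sg
  split_ifs <;> omega

/-- Opposite parities make the frames of parent and child mirror images. The line of `m` starts on
the square (-3, -3) of its gadget. -/
theorem gadget_eq_line {m : ℕ} (hm : m ∈ T.node) (h0 : m ≠ 0) (x y : ℤ) :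
    T.gadget m x y = T.line m (-(x + 3)) (y + 3) := by
  simp only [gadget, line, place, Prod.mk.injEq, sg_eq_neg hm h0]
  constructor <;> ring

/-- In absolute coordinates the line of `k` lies on the diagonal `sg k * x + y = -32 * k`. A
crossing thus determines the pair of nodes, and the smaller one is the parent. A zone stays within
14 of its crossing in both diagonal coordinates, while distinct crossings differ by at least 32 in
one of them. -/
theorem gadget_inj {m m' : ℕ} (hm : m ∈ T.node) (h0 : m ≠ 0) (hm' : m' ∈ T.node) (h0' : m' ≠ 0)
    {x y x' y' : ℤ} (hz : Zone x y) (hz' : Zone x' y')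
    (h : T.gadget m x y = T.gadget m' x' y') : m = m' ∧ x = x' ∧ y = y' := by
  have h1 := T.parity m hm h0
  have h2 := T.parity m' hm' h0'
  have h3 := T.par_lt m hm h0
  have h4 := T.par_lt m' hm' h0'
  obtain ⟨z1, z2, z3, z4⟩ := hz
  obtain ⟨z1', z2', z3', z4'⟩ := hz'
  by_cases hmm : m = m'
  · subst hmm
    exact ⟨rfl, (place_inj (sg_eq _)).1 h⟩
  · exfalso
    simp only [gadget, place, Prod.mk.injEq] at h
    obtain ⟨h5, h6⟩ := h
    rcases sg_cases (T.par m) with ⟨_, h7⟩ | ⟨_, h7⟩ <;>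
      rcases sg_cases (T.par m') with ⟨_, h8⟩ | ⟨_, h8⟩ <;> rw [h7, h8] at h5 <;> omega

/-- The only diagonal with an offset divisible by 32 that meets the zone is `x = y`, which carries
the line of `m` itself; the parent's line `x + y = 0` passes just above. So clearing a line leaves
the gadgets of all other nodes intact. -/
theorem gadget_ne_line {m k : ℕ} (hm : m ∈ T.node) (h0 : m ≠ 0) (hmk : m ≠ k)
    {x y a c : ℤ} (hz : Zone x y) (hac : a + c = 0) : T.gadget m x y ≠ T.line k a c := by
  intro h
  have h1 := T.parity m hm h0
  have h3 := T.par_lt m hm h0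
  obtain ⟨z1, z2, z3, z4⟩ := hz
  simp only [gadget, line, place, Prod.mk.injEq] at h
  obtain ⟨h5, h6⟩ := h
  rcases sg_cases (T.par m) with ⟨_, h7⟩ | ⟨_, h7⟩ <;>
    rcases sg_cases k with ⟨_, h8⟩ | ⟨_, h8⟩ <;> rw [h7, h8] at h5 <;> omega

/-- Gadgets stay in the lower half plane, away from Black's spare pawn on (0, 10). -/
theorem snd_gadget_neg {m : ℕ} (h0 : m ≠ 0) {x y : ℤ} (hz : Zone x y) : (T.gadget m x y).2 < 0 := by
  simp only [gadget, place]
  obtain ⟨z1, z2, z3, z4⟩ := hz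
  omega

theorem gadget_ne_antidiagonal {m : ℕ} (hm : m ∈ T.node) (h0 : m ≠ 0) {x y : ℤ} (hz : Zone x y)
    (a : ℤ) : T.gadget m x y ≠ (a, -a) := by
  intro h
  have h3 := T.parity m hm h0
  have h4 := T.par_lt m hm h0
  obtain ⟨z1, z2, z3, z4⟩ := hz
  simp only [gadget, place, Prod.mk.injEq] at h
  obtain ⟨h5, h6⟩ := h
  rcases sg_cases (T.par m) with ⟨_, h7⟩ | ⟨_, h7⟩ <;> rw [h7] at h5 <;> omega

/-- The black pawns of every line stand on even rows and the landing squares lie on odd rows, so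
crossing lines never block each other. -/
theorem even_coord_iff_line (k : ℕ) (a c : ℤ) : (T.line k a c).2 % 2 = (c + 1) % 2 := by
  simp only [line, place]
  omega

variable (T)

/-- The squares that are initially occupied by black pawns. -/
def IsBlack (s : Square) : Prop :=
  s = (0, 10) ∨ s = (4, -4) ∨
    (∃ k ∈ T.node, ∃ i : ℤ, 3 ≤ i ∧ i % 2 = 1 ∧ s = T.line k i (-i)) ∨
    ∃ m ∈ T.node, m ≠ 0 ∧ ∃ q ∈ blackSquares, s = T.gadget m q.1 q.2

/-- The squares that are initially occupied by red pawns. -/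
def IsRed (s : Square) : Prop :=
  s = (3, -3) ∨ ∃ m ∈ T.node, m ≠ 0 ∧ (s = T.gadget m (-6) (-4) ∨ s = T.gadget m (-3) (-3))

open Classical in
/-- The initial board. -/
noncomputable def board : Board := fun s =>
  if T.IsRed s then some redPawn else if T.IsBlack s then some blackPawn else none

theorem pawnsOnly_board : T.board.PawnsOnly := by
  intro s
  unfold board
  split_ifs <;> simp

variable {T}

theorem board_eq_none {s : Square} (h1 : ¬ T.IsRed s) (h2 : ¬ T.IsBlack s) :
    T.board s = none := by
  unfold board
  rw [if_neg h1, if_neg h2]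

theorem board_eq_black {s : Square} (h1 : ¬ T.IsRed s) (h2 : T.IsBlack s) :
    T.board s = some blackPawn := by
  unfold board
  rw [if_neg h1, if_pos h2]

theorem board_eq_red {s : Square} (h1 : T.IsRed s) : T.board s = some redPawn := by
  unfold board
  rw [if_pos h1]

theorem isRed_of_board_eq {s : Square} (h : T.board s = some redPawn) : T.IsRed s := by
  unfold board at h
  split_ifs at h with h1
  · exact h1
  · cases h

theorem isBlack_of_board_eq {s : Square} (h : T.board s = some blackPawn) : T.IsBlack s := by
  unfold board at h
  split_ifs at h with h1 h2
  · cases h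
  · exact h2

theorem zone_guard : Zone (-6) (-4) ∧ Zone (-3) (-3) := by
  unfold Zone
  norm_num

theorem not_isRed_gadget {m : ℕ} (hm : m ∈ T.node) (h0 : m ≠ 0) {x y : ℤ} (hz : Zone x y)
    (h1 : ¬ (x = -6 ∧ y = -4)) (h2 : ¬ (x = -3 ∧ y = -3)) : ¬ T.IsRed (T.gadget m x y) := by
  rintro (h | ⟨m', hm', h0', h | h⟩)
  · exact gadget_ne_antidiagonal hm h0 hz 3 h
  · exact h1 (gadget_inj hm h0 hm' h0' hz zone_guard.1 h).2
  · exact h2 (gadget_inj hm h0 hm' h0' hz zone_guard.2 h).2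

theorem board_gadget_black {m : ℕ} (hm : m ∈ T.node) (h0 : m ≠ 0) {x y : ℤ}
    (h : (x, y) ∈ blackSquares) : T.board (T.gadget m x y) = some blackPawn := by
  refine board_eq_black (not_isRed_gadget hm h0 (zone_of_mem_blackSquares h) ?_ ?_)
    (Or.inr (Or.inr (Or.inr ⟨m, hm, h0, _, h, rfl⟩)))
  · rintro ⟨rfl, rfl⟩
    revert h
    decide
  · rintro ⟨rfl, rfl⟩
    revert h
    decide

theorem board_gadget_none {m : ℕ} (hm : m ∈ T.node) (h0 : m ≠ 0) {x y : ℤ} (hz : Zone x y)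
    (h : (x, y) ∉ blackSquares) (h1 : ¬ (x = -6 ∧ y = -4)) (h2 : ¬ (x = -3 ∧ y = -3))
    -- This excludes the pawns of the line of `m` itself, which occupy the squares `x = y ≤ -6` with
    -- `x` even.
    (h3 : x ≠ y ∨ -5 ≤ x ∨ x % 2 = 1) : T.board (T.gadget m x y) = none := by
  refine board_eq_none (not_isRed_gadget hm h0 hz h1 h2) ?_
  rintro (h4 | h4 | ⟨k, hk, i, hi, hi', h4⟩ | ⟨m', hm', h0', q, hq, h4⟩)
  · have := snd_gadget_neg (T := T) h0 hz
    rw [h4] at this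
    norm_num at this
  · exact gadget_ne_antidiagonal hm h0 hz 4 h4
  · by_cases hmk : m = k
    · subst hmk
      rw [gadget_eq_line hm h0, line, line, place_inj (sg_eq _)] at h4
      omega
    · exact gadget_ne_line hm h0 hmk hz (by ring) h4
  · obtain ⟨rfl, rfl, rfl⟩ := gadget_inj hm h0 hm' h0' hz (zone_of_mem_blackSquares hq) h4
    exact h hq

theorem not_isRed_line {k : ℕ} (hk : k ∈ T.node) {a : ℤ} (ha : 1 ≤ a) :
    ¬ T.IsRed (T.line k a (-a)) := by
  have key : ∀ m ∈ T.node, m ≠ 0 → ∀ x y, Zone x y → (x = -6 ∧ y = -4 ∨ x = -3 ∧ y = -3) →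
      T.line k a (-a) ≠ T.gadget m x y := by
    intro m hm h0 x y hz hxy h
    by_cases hmk : m = k
    · subst hmk
      rw [gadget_eq_line hm h0, line, line, place_inj (sg_eq _)] at h
      omega
    · exact gadget_ne_line hm h0 hmk hz (by ring) h.symm
  rintro (h | ⟨m, hm, h0, h | h⟩)
  · simp only [line, place, Prod.mk.injEq] at h
    obtain ⟨h5, h6⟩ := h
    rcases sg_cases k with ⟨_, h7⟩ | ⟨_, h7⟩ <;> rw [h7] at h5 <;> omega
  · exact key m hm h0 _ _ zone_guard.1 (by norm_num) h
  · exact key m hm h0 _ _ zone_guard.2 (by norm_num) h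

theorem board_dot {k : ℕ} (hk : k ∈ T.node) {a c : ℤ} (ha : 3 ≤ a) (ha' : a % 2 = 1)
    (hac : a + c = 0) : T.board (T.line k a c) = some blackPawn := by
  obtain rfl : c = -a := by omega
  exact board_eq_black (not_isRed_line hk (by omega))
    (Or.inr (Or.inr (Or.inl ⟨k, hk, a, ha, ha', rfl⟩)))

/-- For `k ≠ 0` the landing square with coordinate 2 initially holds the plug of the gadget of `k`,
hence the stronger bound. -/
theorem board_landing {k : ℕ} (hk : k ∈ T.node) {a c : ℤ} (ha : 2 ≤ a) (hk0 : k ≠ 0 → 4 ≤ a)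
    (ha' : a % 2 = 0) (hac : a + c = 0) : T.board (T.line k a c) = none := by
  obtain rfl : c = -a := by omega
  refine board_eq_none (not_isRed_line hk (by omega)) ?_
  rintro (h | h | ⟨k', hk', i, hi, hi', h⟩ | ⟨m', hm', h0', q, hq, h⟩)
  · simp only [line, place, Prod.mk.injEq] at h
    omega
  · have := T.even_coord_iff_line k a (-a)
    rw [h] at this
    omega
  · have h1 := T.even_coord_iff_line k a (-a)
    have h2 := T.even_coord_iff_line k' i (-i)
    rw [h] at h1
    omega
  · by_cases hmk : m' = k
    · subst hmk
      rw [gadget_eq_line hm' h0', line, line, place_inj (sg_eq _)] at h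
      have := diagonal_of_mem_blackSquares hq (by omega)
      have := hk0 h0'
      omega
    · exact gadget_ne_line hm' h0' hmk (zone_of_mem_blackSquares hq) (by ring) h.symm

/-- The diagonal just below a line decides where sideways jumps are possible. It meets only the
gadget of `k` itself and, along their upper edges, those of its children. -/
theorem gadget_eq_side {m k : ℕ} (hm : m ∈ T.node) (h0 : m ≠ 0) (hk : k ∈ T.node) {x y a c : ℤ}
    (hz : Zone x y) (hac : a + c = -2) (h : T.gadget m x y = T.line k a c) :
    m = k ∧ a = -(x + 3) ∧ c = y + 3 ∨
      T.par m = k ∧ a = 16 * (m - T.par k) - 3 + x ∧ x + y = -2 := by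
  by_cases hmk : m = k
  · subst hmk
    rw [gadget_eq_line hm h0, line, line, place_inj (sg_eq _)] at h
    exact Or.inl ⟨rfl, h.1.symm, h.2.symm⟩
  · right
    have hp : T.par m = k := by
      have h1 := T.parity m hm h0
      have h3 := T.par_lt m hm h0
      obtain ⟨z1, z2, z3, z4⟩ := hz
      simp only [gadget, line, place, Prod.mk.injEq] at h
      obtain ⟨h5, h6⟩ := h
      rcases sg_cases (T.par m) with ⟨_, h7⟩ | ⟨_, h7⟩ <;>
        rcases sg_cases k with ⟨_, h8⟩ | ⟨_, h8⟩ <;> rw [h7, h8] at h5 <;> omega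
    subst hp
    rw [gadget_eq_line_par, line, line, place_inj (sg_eq _)] at h
    exact ⟨rfl, h.1.symm, by omega⟩

/-- The squares of the line of `k`, given by their first coordinate, at which a pawn can turn off
towards the gadget of a child. -/
def exits (T : NatTree) (k : ℕ) : Set ℤ :=
  {x | ∃ m ∈ T.node, m ≠ 0 ∧ T.par m = k ∧ x = 16 * (m - T.par k) - 2}

/-- Apart from the turn-offs, the only black pawn beside this part of the line is the one on (-6,
-8) in the gadget of `k`; the pawn on (-5, -9) is there to prevent its capture. -/
theorem board_side {k : ℕ} (hk : k ∈ T.node) {x y : ℤ} (hx : x % 2 = 0) (hx0 : 0 ≤ x)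
    (hk0 : k ≠ 0 → 4 ≤ x) (hxJ : x ∉ T.exits k) (hxy : x + y = 0)
    (h : T.board (T.line k (x + -1) (y + -1)) = some blackPawn) :
    T.board (T.line k (x + -1 + -1) (y + -1 + -1)) ≠ none := by
  obtain rfl : y = -x := by omega
  rcases isBlack_of_board_eq h with h | h | ⟨k', hk', i, hi, hi', h⟩ | ⟨m, hm, h0, q, hq, h⟩
  · simp only [line, place, Prod.mk.injEq] at h
    omega
  · exfalso
    simp only [line, place, Prod.mk.injEq] at h
    obtain ⟨h5, h6⟩ := h
    rcases sg_cases k with ⟨_, h7⟩ | ⟨_, h7⟩ <;> rw [h7] at h5 <;> omega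
  · exfalso
    simp only [line, place, Prod.mk.injEq] at h
    obtain ⟨h5, h6⟩ := h
    rcases sg_cases k with ⟨_, h7⟩ | ⟨_, h7⟩ <;>
      rcases sg_cases k' with ⟨_, h8⟩ | ⟨_, h8⟩ <;> rw [h7, h8] at h5 <;> omega
  · rcases gadget_eq_side hm h0 hk (zone_of_mem_blackSquares hq) (by ring) h.symm with
      ⟨rfl, h1, h2⟩ | ⟨rfl, h1, h2⟩
    · have h4 := hk0 h0
      have h5 : q = (-6, -8) := by
        have h6 : q.1 ≤ -6 := by omega
        have h7 : q.2 = q.1 - 2 := by omega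
        clear h h1 h2
        revert q
        decide
      subst h5
      have h8 := board_gadget_black (x := -5) (y := -9) hm h0 (by decide)
      rw [gadget_eq_line hm h0] at h8
      have h9 : x = 4 := by omega
      subst h9
      norm_num at h8 ⊢
      rw [h8]
      simp
    · exfalso
      apply hxJ
      have h5 : q = (0, -2) ∨ q = (-2, 0) ∨ q.1 = -1 := by
        clear h h1
        revert q
        decide
      refine ⟨m, hm, h0, rfl, ?_⟩
      have : q = (0, -2) := by
        clear h h1 h5
        revert q
        decide
      subst this
      dsimp only at h1
      omega

end NatTree

/-! ### The forced exchange in a gadget -/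

namespace NatTree

variable (T : NatTree)

/-- All pieces of the gadget of `m` are in their initial places. -/
def Intact (b : Board) (m : ℕ) : Prop :=
  (∀ x y, (x, y) ∈ blackSquares → b (T.gadget m x y) = some blackPawn) ∧
    b (T.gadget m (-6) (-4)) = some redPawn ∧ b (T.gadget m (-3) (-3)) = some redPawn

/-- The square `s` is occupied by one of the red pawns of an intact gadget, of a node different
from `k`. -/
def Guarded (b : Board) (k : ℕ) (s : Square) : Prop :=
  ∃ m ∈ T.node, m ≠ 0 ∧ m ≠ k ∧ T.Intact b m ∧
    (s = T.gadget m (-6) (-4) ∨ s = T.gadget m (-3) (-3))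

/-- Black has a pawn that is free to make a move. -/
def HasFreePawn (b : Board) : Prop := b (0, 10) = some blackPawn ∧ b (1, 11) = none

variable {T}

theorem Intact.congr {b b' : Board} {m : ℕ} (h : T.Intact b m)
    (hb : ∀ x y, Zone x y → b' (T.gadget m x y) = b (T.gadget m x y)) : T.Intact b' m :=
  ⟨fun x y hq => (hb _ _ (zone_of_mem_blackSquares hq)).trans (h.1 x y hq),
    (hb _ _ zone_guard.1).trans h.2.1, (hb _ _ zone_guard.2).trans h.2.2⟩

theorem intact_board {m : ℕ} (hm : m ∈ T.node) (h0 : m ≠ 0) : T.Intact T.board m :=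
  ⟨fun _ _ hq => board_gadget_black hm h0 hq,
    board_eq_red (Or.inr ⟨m, hm, h0, Or.inl rfl⟩), board_eq_red (Or.inr ⟨m, hm, h0, Or.inr rfl⟩)⟩

theorem gadget_val {b : Board} {m : ℕ} {x y x' y' : ℤ} {v : Option Piece}
    (h : b (T.gadget m x y) = v) (hx : x' = x) (hy : y' = y) : b (T.gadget m x' y') = v := by
  rw [hx, hy, h]

theorem gadget_ne_none {b : Board} {m : ℕ} {x y x' y' : ℤ} {a : Piece}
    (h : b (T.gadget m x y) = some a) (hx : x' = x) (hy : y' = y) :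
    b (T.gadget m x' y') ≠ none := by
  rw [hx, hy, h]
  exact Option.some_ne_none a

theorem Guarded.locked {b : Board} {k : ℕ} {s : Square} (h : T.Guarded b k s) : b.Locked s := by
  obtain ⟨m, hm, h0, _, ⟨h1, h2, h3⟩, rfl | rfl⟩ := h
  · refine locked_place (sg_eq _) h2 ?_
    rintro ε (rfl | rfl)
    · refine ⟨gadget_val (h1 (-5) (-5) (by decide)) (by norm_num) (by norm_num), ?_, ?_⟩
      · exact gadget_ne_none (h1 (-4) (-6) (by decide)) (by norm_num) (by norm_num)
      · exact gadget_ne_none (h1 (-7) (-3) (by decide)) (by norm_num) (by norm_num)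
    · refine ⟨gadget_val (h1 (-7) (-5) (by decide)) (by norm_num) (by norm_num), ?_, ?_⟩
      · exact gadget_ne_none (h1 (-8) (-6) (by decide)) (by norm_num) (by norm_num)
      · exact gadget_ne_none (h1 (-5) (-3) (by decide)) (by norm_num) (by norm_num)
  · refine locked_place (sg_eq _) h3 ?_
    rintro ε (rfl | rfl)
    · refine ⟨gadget_val (h1 (-2) (-4) (by decide)) (by norm_num) (by norm_num), ?_, ?_⟩
      · exact gadget_ne_none (h1 (-1) (-5) (by decide)) (by norm_num) (by norm_num)
      · exact gadget_ne_none (h1 (-4) (-2) (by decide)) (by norm_num) (by norm_num)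
    · refine ⟨gadget_val (h1 (-4) (-4) (by decide)) (by norm_num) (by norm_num), ?_, ?_⟩
      · exact gadget_ne_none (h1 (-5) (-5) (by decide)) (by norm_num) (by norm_num)
      · exact gadget_ne_none (h1 (-2) (-2) (by decide)) (by norm_num) (by norm_num)

variable (T)

/-- The situation while the gadget of `m` is in action. The last six arguments are the contents of
those squares that change. -/
structure Stage (m : ℕ) (b : Board) (Y X Z B V G : Option Piece) : Prop where
  pawns : b.PawnsOnly
  free : HasFreePawn b
  below : ∀ x y, y ≤ -8 → b (T.gadget m x y) = T.board (T.gadget m x y)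
  guard : b (T.gadget m (-3) (-3)) = some redPawn
  black : ∀ x y, (x, y) ∈ [((-4, -4) : ℤ × ℤ), (-7, -3), (-5, -3), (-7, -5), (-8, -6), (-4, -2),
    (-2, -2), (-1, -5), (-6, -8), (-6, -6)] → b (T.gadget m x y) = some blackPawn
  empty : ∀ x y, (x, y) ∈ [((-1, -3) : ℤ × ℤ), (-3, -7), (-7, -7)] → b (T.gadget m x y) = none
  eqY : b (T.gadget m (-2) (-4)) = Y
  eqX : b (T.gadget m (-3) (-5)) = X
  eqZ : b (T.gadget m (-4) (-6)) = Z
  eqB : b (T.gadget m (-5) (-7)) = B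
  eqV : b (T.gadget m (-5) (-5)) = V
  eqG : b (T.gadget m (-6) (-4)) = G
  red : ∀ x y, b (T.gadget m x y) = some redPawn →
    (x, y) ∈ [((-3, -5) : ℤ × ℤ), (-4, -6), (-6, -4), (-3, -3)] ∨ T.Guarded b m (T.gadget m x y)

variable {T}

theorem exists_gadget (m : ℕ) (s : Square) : ∃ x y, s = T.gadget m x y :=
  exists_place _ (sg_eq _) s

theorem exists_line (k : ℕ) (s : Square) : ∃ x y, s = T.line k x y :=
  exists_place _ (sg_eq _) s

theorem jump_gadget (b : Board) (m : ℕ) (x y ε δ x' y' : ℤ) :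
    b.jump (T.gadget m x y) (sg (T.par m) * ε, δ) (T.gadget m x' y') =
      if x' = x + ε + ε ∧ y' = y + δ + δ then b (T.gadget m x y)
      else if x' = x + ε ∧ y' = y + δ then none
      else if x' = x ∧ y' = y then none else b (T.gadget m x' y') :=
  Board.jump_place _ (sg_eq _) _ _ _ _ _ _

theorem Guarded.congr {b b' : Board} {m k : ℕ} {s : Square} (h : T.Guarded b k s)
    (hm : m ∈ T.node) (h0 : m ≠ 0) (hs : m = k)
    (hb : ∀ x y, ¬ Zone x y → b' (T.gadget m x y) = b (T.gadget m x y)) : T.Guarded b' k s := by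
  obtain ⟨m', hm', h0', hk, h1, h2⟩ := h
  refine ⟨m', hm', h0', hk, h1.congr fun x y hz => ?_, h2⟩
  obtain ⟨x', y', h3⟩ := exists_gadget (T := T) m (T.gadget m' x y)
  rw [h3]
  exact hb _ _ fun hz' => hk ((gadget_inj hm' h0' hm h0 hz hz' h3).1.trans hs)

theorem not_zone_of_snd_nonneg {m : ℕ} (h0 : m ≠ 0) {x y : ℤ} (h : 0 ≤ (T.gadget m x y).2) :
    ¬ Zone x y := fun hz => absurd (snd_gadget_neg h0 hz) (not_lt.2 h)

theorem HasFreePawn.congr {b b' : Board} (h : HasFreePawn b) {m : ℕ} (h0 : m ≠ 0)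
    (hb : ∀ x y, ¬ Zone x y → b' (T.gadget m x y) = b (T.gadget m x y)) : HasFreePawn b' := by
  have key : ∀ s : Square, 0 ≤ s.2 → b' s = b s := by
    intro s hs
    obtain ⟨x, y, rfl⟩ := exists_gadget (T := T) m s
    exact hb x y (not_zone_of_snd_nonneg h0 hs)
  exact ⟨(key (0, 10) (by norm_num)).trans h.1, (key (1, 11) (by norm_num)).trans h.2⟩

namespace Stage

variable {m : ℕ} {b : Board}

theorem canJump_capture (h : T.Stage m b none (some redPawn) (some blackPawn) (some blackPawn)
    (some blackPawn) (some redPawn)) :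
    b.CanJump .black (T.gadget m (-4) (-6)) (sg (T.par m) * 1, 1) :=
  h.pawns.canJump_black_of_place (sg_eq _) (Or.inl rfl) h.eqZ h.eqX h.eqY

/-- Each red pawn within the gadget is shielded by an occupied square behind it, except the one that
has just arrived; pawns of other gadgets are locked. -/
theorem eq_of_canJump_capture (h : T.Stage m b none (some redPawn) (some blackPawn)
    (some blackPawn) (some blackPawn) (some redPawn)) (s d : Square) (hj : b.CanJump .black s d) :
    s = T.gadget m (-4) (-6) ∧ d = (sg (T.par m) * 1, 1) := by
  obtain ⟨_, _, _, hr, _⟩ := (h.pawns.canJump_black_iff _ _).1 hj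
  obtain ⟨x, y, hs⟩ := exists_gadget (T := T) m (s + d)
  rw [hs] at hr
  rcases h.red x y hr with hm | hg
  · obtain ⟨ε, hε, rfl, rfl, h1, h2⟩ := h.pawns.canJump_black_place (sg_eq _) hj hs
    simp only [List.mem_cons, Prod.mk.injEq, List.not_mem_nil, or_false] at hm
    rcases hm with ⟨rfl, rfl⟩ | ⟨rfl, rfl⟩ | ⟨rfl, rfl⟩ | ⟨rfl, rfl⟩ <;> rcases hε with rfl | rfl
    · exact ⟨rfl, rfl⟩
    · exact absurd h2 (gadget_ne_none (h.black (-4) (-4) (by decide)) (by norm_num) (by norm_num))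
    · exact absurd (hr.symm.trans h.eqZ) (by simp)
    · exact absurd (hr.symm.trans h.eqZ) (by simp)
    · exact absurd h2 (gadget_ne_none (h.black (-5) (-3) (by decide)) (by norm_num) (by norm_num))
    · exact absurd h2 (gadget_ne_none (h.black (-7) (-3) (by decide)) (by norm_num) (by norm_num))
    · exact absurd h2 (gadget_ne_none (h.black (-2) (-2) (by decide)) (by norm_num) (by norm_num))
    · exact absurd h2 (gadget_ne_none (h.black (-4) (-2) (by decide)) (by norm_num) (by norm_num))
  · rw [← hs] at hg
    exact absurd hj (hg.locked.not_captured h.pawns)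

/-- A jump in the gadget does not affect anything but the three squares involved. -/
theorem zone_congr {x y ε δ : ℤ} (h1 : Zone x y) (h2 : Zone (x + ε) (y + δ))
    (h3 : Zone (x + ε + ε) (y + δ + δ)) (x' y' : ℤ) (hz : ¬ Zone x' y') :
    b.jump (T.gadget m x y) (sg (T.par m) * ε, δ) (T.gadget m x' y') = b (T.gadget m x' y') := by
  rw [jump_gadget, if_neg, if_neg, if_neg]
  all_goals
    rintro ⟨rfl, rfl⟩
    contradiction

theorem capture (hm : m ∈ T.node) (h0 : m ≠ 0) (h : T.Stage m b none (some redPawn)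
    (some blackPawn) (some blackPawn) (some blackPawn) (some redPawn)) :
    T.Stage m (b.jump (T.gadget m (-4) (-6)) (sg (T.par m) * 1, 1)) (some blackPawn) none none
      (some blackPawn) (some blackPawn) (some redPawn) := by
  have hz := zone_congr (T := T) (m := m) (b := b) (x := -4) (y := -6) (ε := 1) (δ := 1)
    (by unfold Zone; norm_num) (by unfold Zone; norm_num) (by unfold Zone; norm_num)
  constructor
  · exact h.pawns.jump _ _
  · exact h.free.congr h0 hz
  · intro x y hy
    rw [jump_gadget, if_neg (by omega), if_neg (by omega), if_neg (by omega), h.below x y hy]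
  · rw [jump_gadget]
    simpa using h.guard
  · intro x y hq
    rw [jump_gadget, h.black x y hq]
    simp only [List.mem_cons, Prod.mk.injEq, List.not_mem_nil, or_false] at hq
    rw [if_neg (by omega), if_neg (by omega), if_neg (by omega)]
  · intro x y hq
    rw [jump_gadget, h.empty x y hq]
    simp only [List.mem_cons, Prod.mk.injEq, List.not_mem_nil, or_false] at hq
    rw [if_neg (by omega), if_neg (by omega), if_neg (by omega)]
  · rw [jump_gadget]
    simpa using h.eqZ
  · rw [jump_gadget]
    simp
  · rw [jump_gadget]
    simp
  · rw [jump_gadget]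
    simpa using h.eqB
  · rw [jump_gadget]
    simpa using h.eqV
  · rw [jump_gadget]
    simpa using h.eqG
  · intro x y hr
    rw [jump_gadget] at hr
    split_ifs at hr with h1 h2 h3
    · exact absurd (hr.symm.trans h.eqZ) (by simp)
    · exact (h.red x y hr).imp_right fun hg => hg.congr hm h0 rfl hz

theorem canJump_release (h : T.Stage m b (some blackPawn) none none (some blackPawn)
    (some blackPawn) (some redPawn)) :
    b.CanJump .red (T.gadget m (-6) (-4)) (sg (T.par m) * 1, -1) :=
  h.pawns.canJump_red_of_place (sg_eq _) (Or.inl rfl) h.eqG h.eqV h.eqZ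

/-- The pawn on (-3, -3) is still blocked by the plug on (-5, -5). Only the guard can jump, into the
square that the capturing pawn has vacated. -/
theorem eq_of_canJump_release (h : T.Stage m b (some blackPawn) none none (some blackPawn)
    (some blackPawn) (some redPawn)) (s d : Square) (hj : b.CanJump .red s d) :
    s = T.gadget m (-6) (-4) ∧ d = (sg (T.par m) * 1, -1) := by
  obtain ⟨_, _, hr, _, _⟩ := (h.pawns.canJump_red_iff _ _).1 hj
  obtain ⟨x, y, rfl⟩ := exists_gadget (T := T) m s
  rcases h.red x y hr with hm | hg
  · obtain ⟨ε, hε, rfl, _, h1, h2⟩ := h.pawns.canJump_red_place (sg_eq _) hj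
    simp only [List.mem_cons, Prod.mk.injEq, List.not_mem_nil, or_false] at hm
    rcases hm with ⟨rfl, rfl⟩ | ⟨rfl, rfl⟩ | ⟨rfl, rfl⟩ | ⟨rfl, rfl⟩ <;> rcases hε with rfl | rfl
    · exact absurd (hr.symm.trans h.eqX) (by simp)
    · exact absurd (hr.symm.trans h.eqX) (by simp)
    · exact absurd (hr.symm.trans h.eqZ) (by simp)
    · exact absurd (hr.symm.trans h.eqZ) (by simp)
    · exact ⟨rfl, rfl⟩
    · exact absurd h2 (gadget_ne_none (h.black (-8) (-6) (by decide)) (by norm_num) (by norm_num))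
    · exact absurd h2 (gadget_ne_none (h.black (-1) (-5) (by decide)) (by norm_num) (by norm_num))
    · exact absurd h2 (gadget_ne_none h.eqV (by norm_num) (by norm_num))
  · exact absurd hj (hg.locked.not_canJump h.pawns d)

theorem release (hm : m ∈ T.node) (h0 : m ≠ 0) (h : T.Stage m b (some blackPawn) none none
    (some blackPawn) (some blackPawn) (some redPawn)) :
    T.Stage m (b.jump (T.gadget m (-6) (-4)) (sg (T.par m) * 1, -1)) (some blackPawn) none
      (some redPawn) (some blackPawn) none none := by
  have hz := zone_congr (T := T) (m := m) (b := b) (x := -6) (y := -4) (ε := 1) (δ := -1)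
    (by unfold Zone; norm_num) (by unfold Zone; norm_num) (by unfold Zone; norm_num)
  constructor
  · exact h.pawns.jump _ _
  · exact h.free.congr h0 hz
  · intro x y hy
    rw [jump_gadget, if_neg (by omega), if_neg (by omega), if_neg (by omega), h.below x y hy]
  · rw [jump_gadget]
    simpa using h.guard
  · intro x y hq
    rw [jump_gadget, h.black x y hq]
    simp only [List.mem_cons, Prod.mk.injEq, List.not_mem_nil, or_false] at hq
    rw [if_neg (by omega), if_neg (by omega), if_neg (by omega)]
  · intro x y hq
    rw [jump_gadget, h.empty x y hq]
    simp only [List.mem_cons, Prod.mk.injEq, List.not_mem_nil, or_false] at hq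
    rw [if_neg (by omega), if_neg (by omega), if_neg (by omega)]
  · rw [jump_gadget]
    simpa using h.eqY
  · rw [jump_gadget]
    simpa using h.eqX
  · rw [jump_gadget]
    simpa using h.eqG
  · rw [jump_gadget]
    simpa using h.eqB
  · rw [jump_gadget]
    simp
  · rw [jump_gadget]
    simp
  · intro x y hr
    rw [jump_gadget] at hr
    split_ifs at hr with h1 h2 h3
    · obtain ⟨rfl, rfl⟩ := h1
      exact Or.inl (by decide)
    · exact (h.red x y hr).imp_right fun hg => hg.congr hm h0 rfl hz

theorem canJump_recapture (h : T.Stage m b (some blackPawn) none (some redPawn) (some blackPawn)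
    none none) : b.CanJump .black (T.gadget m (-5) (-7)) (sg (T.par m) * 1, 1) :=
  h.pawns.canJump_black_of_place (sg_eq _) (Or.inl rfl) h.eqB h.eqZ h.eqX

theorem eq_of_canJump_recapture (h : T.Stage m b (some blackPawn) none (some redPawn)
    (some blackPawn) none none) (s d : Square) (hj : b.CanJump .black s d) :
    s = T.gadget m (-5) (-7) ∧ d = (sg (T.par m) * 1, 1) := by
  obtain ⟨_, _, _, hr, _⟩ := (h.pawns.canJump_black_iff _ _).1 hj
  obtain ⟨x, y, hs⟩ := exists_gadget (T := T) m (s + d)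
  rw [hs] at hr
  rcases h.red x y hr with hm | hg
  · obtain ⟨ε, hε, rfl, rfl, h1, h2⟩ := h.pawns.canJump_black_place (sg_eq _) hj hs
    simp only [List.mem_cons, Prod.mk.injEq, List.not_mem_nil, or_false] at hm
    rcases hm with ⟨rfl, rfl⟩ | ⟨rfl, rfl⟩ | ⟨rfl, rfl⟩ | ⟨rfl, rfl⟩ <;> rcases hε with rfl | rfl
    · exact absurd (hr.symm.trans h.eqX) (by simp)
    · exact absurd (hr.symm.trans h.eqX) (by simp)
    · exact ⟨rfl, rfl⟩
    · exact absurd (h1.symm.trans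
        (gadget_val (h.empty (-3) (-7) (by decide)) (by norm_num) (by norm_num))) (by simp)
    · exact absurd (hr.symm.trans h.eqG) (by simp)
    · exact absurd (hr.symm.trans h.eqG) (by simp)
    · exact absurd h2 (gadget_ne_none (h.black (-2) (-2) (by decide)) (by norm_num) (by norm_num))
    · exact absurd h2 (gadget_ne_none (h.black (-4) (-2) (by decide)) (by norm_num) (by norm_num))
  · rw [← hs] at hg
    exact absurd hj (hg.locked.not_captured h.pawns)

/-- The guard is eliminated by the pawn on (-5, -7), so that the top of the line of `m` holds the
only red pawn left from this gadget. -/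
theorem recapture (hm : m ∈ T.node) (h0 : m ≠ 0) (h : T.Stage m b (some blackPawn) none
    (some redPawn) (some blackPawn) none none) :
    T.Stage m (b.jump (T.gadget m (-5) (-7)) (sg (T.par m) * 1, 1)) (some blackPawn)
      (some blackPawn) none none none none := by
  have hz := zone_congr (T := T) (m := m) (b := b) (x := -5) (y := -7) (ε := 1) (δ := 1)
    (by unfold Zone; norm_num) (by unfold Zone; norm_num) (by unfold Zone; norm_num)
  constructor
  · exact h.pawns.jump _ _
  · exact h.free.congr h0 hz
  · intro x y hy
    rw [jump_gadget, if_neg (by omega), if_neg (by omega), if_neg (by omega), h.below x y hy]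
  · rw [jump_gadget]
    simpa using h.guard
  · intro x y hq
    rw [jump_gadget, h.black x y hq]
    simp only [List.mem_cons, Prod.mk.injEq, List.not_mem_nil, or_false] at hq
    rw [if_neg (by omega), if_neg (by omega), if_neg (by omega)]
  · intro x y hq
    rw [jump_gadget, h.empty x y hq]
    simp only [List.mem_cons, Prod.mk.injEq, List.not_mem_nil, or_false] at hq
    rw [if_neg (by omega), if_neg (by omega), if_neg (by omega)]
  · rw [jump_gadget]
    simpa using h.eqY
  · rw [jump_gadget]
    simpa using h.eqB
  · rw [jump_gadget]
    simp
  · rw [jump_gadget]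
    simp
  · rw [jump_gadget]
    simpa using h.eqV
  · rw [jump_gadget]
    simpa using h.eqG
  · intro x y hr
    rw [jump_gadget] at hr
    split_ifs at hr with h1 h2 h3
    · exact absurd (hr.symm.trans h.eqB) (by simp)
    · exact (h.red x y hr).imp_right fun hg => hg.congr hm h0 rfl hz

theorem not_canJump_capture (h : T.Stage m b (some blackPawn) none none (some blackPawn)
    (some blackPawn) (some redPawn)) (d : Square) :
    ¬ b.CanJump .black (T.gadget m (-2) (-4)) d := by
  intro hj
  obtain ⟨ε, rfl | rfl, h1, h2⟩ := h.pawns.canJump_black_from_place (sg_eq _) hj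
  · exact absurd (h1.symm.trans
      (gadget_val (h.empty (-1) (-3) (by decide)) (by norm_num) (by norm_num))) (by simp)
  · exact absurd h2 (gadget_ne_none (h.black (-4) (-2) (by decide)) (by norm_num) (by norm_num))

/-- The pawn on (-6, -8) keeps the guard from continuing over (-5, -7). -/
theorem not_canJump_release (h : T.Stage m b (some blackPawn) none (some redPawn)
    (some blackPawn) none none) (d : Square) :
    ¬ b.CanJump .red (T.gadget m (-4) (-6)) d := by
  intro hj
  obtain ⟨ε, rfl | rfl, _, _, h1, h2⟩ := h.pawns.canJump_red_place (sg_eq _) hj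
  · exact absurd (h1.symm.trans
      (gadget_val (h.empty (-3) (-7) (by decide)) (by norm_num) (by norm_num))) (by simp)
  · exact absurd h2 (gadget_ne_none (h.black (-6) (-8) (by decide)) (by norm_num) (by norm_num))

theorem not_canJump_recapture (h : T.Stage m b (some blackPawn) (some blackPawn) none none
    none none) (d : Square) : ¬ b.CanJump .black (T.gadget m (-3) (-5)) d := by
  intro hj
  obtain ⟨ε, rfl | rfl, h1, h2⟩ := h.pawns.canJump_black_from_place (sg_eq _) hj
  · exact absurd (h1.symm.trans (gadget_val h.eqY (by norm_num) (by norm_num))) (by simp)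
  · exact absurd (h1.symm.trans
      (gadget_val (h.black (-4) (-4) (by decide)) (by norm_num) (by norm_num))) (by simp)

end Stage

end NatTree

/-! ### Passing from the line of a node to that of a child -/

namespace NatTree

variable (T : NatTree)

/-- Red is to move, and the pawn at the beginning of the line of `k` is the only red piece that
can. -/
structure Ready (k : ℕ) (b : Board) : Prop where
  pawns : b.PawnsOnly
  free : HasFreePawn b
  below : ∀ x y, y ≤ -5 → b (T.line k x y) = T.board (T.line k x y)
  start : b (T.line k 0 0) = some redPawn
  dot₁ : b (T.line k 1 (-1)) = some blackPawn
  dot₃ : b (T.line k 3 (-3)) = some blackPawn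
  landing₂ : b (T.line k 2 (-2)) = none
  landing₄ : b (T.line k 4 (-4)) = none
  side₀ : b (T.line k (-1) (-1)) = some blackPawn → b (T.line k (-2) (-2)) ≠ none
  side₂ : b (T.line k 1 (-3)) = some blackPawn → b (T.line k 0 (-4)) ≠ none
  red : ∀ x y, b (T.line k x y) = some redPawn →
    x = 0 ∧ y = 0 ∨ T.Guarded b k (T.line k x y)

variable {T}

/-- The crossing has coordinate `x - 1` on the parent's line, so the turn-off is the square (1, -1)
of the gadget, one step past the crossing. -/
theorem gadget_line_of_exit {k m : ℕ} {x : ℤ} (hp : T.par m = k)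
    (hx : x = 16 * (m - T.par k) - 2) (u v : ℤ) :
    T.gadget m u v = T.line k (x - 1 + u) (-(x - 1) + v) := by
  subst hp hx
  rw [gadget_eq_line_par]
  congr 1 <;> ring

/-- Since `T.par k ≤ k < m`, every turn-off lies far enough down the line for its gadget to be in
the part of the board that is still initial. -/
theorem exit_bound {k m : ℕ} {x : ℤ} (hm : m ∈ T.node) (h0 : m ≠ 0) (hp : T.par m = k)
    (hk : k ≠ 0 → T.par k < k) (hx : x = 16 * (m - T.par k) - 2) : 14 ≤ x := by
  have h1 := T.par_lt m hm h0
  have h2 : T.par k ≤ k := by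
    by_cases h : k = 0
    · subst h
      exact T.par_zero.le
    · exact (hk h).le
  omega

theorem mem_blackSquares_of_ne : ∀ q ∈ [((-4, -4) : ℤ × ℤ), (-7, -3), (-5, -3), (-7, -5), (-8, -6),
    (-4, -2), (-2, -2), (-1, -5), (-6, -8), (-6, -6)], q ≠ (-6, -6) → q ∈ blackSquares ∧
      q.2 ≤ -2 ∧ q.1 + q.2 < 0 ∧ ¬ (q.1 = 0 ∧ q.2 = -2) ∧ ¬ (q.1 = -2 ∧ q.2 = -4) := by
  decide

theorem snd_line_neg (k : ℕ) {x y : ℤ} (hy : y ≤ 0) : (T.line k x y).2 < 0 := by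
  simp only [line, place]
  omega

theorem HasFreePawn.congr_line {b b' : Board} (h : HasFreePawn b) (k : ℕ)
    (hb : ∀ x y, 0 < y → b' (T.line k x y) = b (T.line k x y)) : HasFreePawn b' := by
  have key : ∀ s : Square, 0 ≤ s.2 → b' s = b s := by
    intro s hs
    obtain ⟨x, y, rfl⟩ := exists_line (T := T) k s
    refine hb x y ?_
    by_contra hy
    exact absurd (snd_line_neg (T := T) k (x := x) (not_lt.1 hy)) (not_lt.2 hs)
  exact ⟨(key (0, 10) (by norm_num)).trans h.1, (key (1, 11) (by norm_num)).trans h.2⟩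

namespace Ready

variable {k : ℕ} {b : Board}

theorem board_eq_of_exit (h : T.Ready k b) {m : ℕ} {x : ℤ} (hp : T.par m = k)
    (hx : x = 16 * (m - T.par k) - 2) (hx14 : 14 ≤ x) {u v u' v' : ℤ} (hu : u = x - 1 + u')
    (hv : v = -(x - 1) + v') (hv' : v' ≤ 0) :
    b (T.line k u v) = T.board (T.gadget m u' v') := by
  rw [h.below _ _ (by omega), gadget_line_of_exit hp hx, hu, hv]

theorem track (hk : k ∈ T.node) (h : T.Ready k b) :
    Track b (sg k * (3 - 16 * (k - T.par k)), -3 - 16 * (k + T.par k)) (sg k) (T.exits k) where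
  sign := sg_eq k
  pawns := h.pawns
  start := h.start
  others s d hj := by
    obtain ⟨_, _, hr, _, _⟩ := (h.pawns.canJump_red_iff _ _).1 hj
    obtain ⟨x, y, rfl⟩ := exists_line (T := T) k s
    rcases h.red x y hr with ⟨rfl, rfl⟩ | hg
    · rfl
    · exact absurd hj (hg.locked.not_canJump h.pawns d)
  dot x y hx hx0 hxy := by
    obtain rfl : y = -x := by omega
    -- The exchange may have changed the rows above -5, so the first squares of the line are
    -- recorded separately in `Ready`.
    rcases (by omega : x = 1 ∨ x = 3 ∨ 5 ≤ x) with rfl | rfl | hx5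
    · exact h.dot₁
    · exact h.dot₃
    · exact (h.below x (-x) (by omega)).trans (board_dot hk (by omega) hx hxy)
  landing x y hx hx0 hxy := by
    obtain rfl : y = -x := by omega
    rcases (by omega : x = 2 ∨ x = 4 ∨ 6 ≤ x) with rfl | rfl | hx6
    · exact h.landing₂
    · exact h.landing₄
    · exact (h.below x (-x) (by omega)).trans
        (board_landing hk (by omega) (fun _ => by omega) hx hxy)
  side x hx hx0 hJ y hxy := by
    obtain rfl : y = -x := by omega
    rcases (by omega : x = 0 ∨ x = 2 ∨ 4 ≤ x) with rfl | rfl | hx4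
    · exact h.side₀
    · exact h.side₂
    · change b (T.line k _ _) = _ → b (T.line k _ _) ≠ _
      rw [h.below _ _ (by omega), h.below _ _ (by omega)]
      exact board_side hk hx hx0 (fun _ => hx4) hJ hxy
  exit_dot x := by
    rintro ⟨m, hm, h0, hp, hx⟩ y hy
    have hx14 := exit_bound hm h0 hp (T.par_lt k hk) hx
    exact (h.board_eq_of_exit hp hx hx14 (u' := 0) (v' := -2) (by omega) (by omega)
      (by omega)).trans (board_gadget_black hm h0 (by decide))
  exit_landing x := by
    rintro ⟨m, hm, h0, hp, hx⟩ u v hu hv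
    have hx14 := exit_bound hm h0 hp (T.par_lt k hk) hx
    exact (h.board_eq_of_exit hp hx hx14 (u' := -1) (v' := -3) (by omega) (by omega)
      (by omega)).trans (board_gadget_none hm h0 (by unfold Zone; omega) (by decide) (by omega)
      (by omega) (by omega))
  exit_side x := by
    rintro ⟨m, hm, h0, hp, hx⟩ u v hu hv
    have hx14 := exit_bound hm h0 hp (T.par_lt k hk) hx
    exact (h.board_eq_of_exit hp hx hx14 (u' := 0) (v' := -4) (by omega) (by omega)
      (by omega)).trans (board_gadget_none hm h0 (by unfold Zone; omega) (by decide) (by omega)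
      (by omega) (by omega))
  exit_dot' x := by
    rintro ⟨m, hm, h0, hp, hx⟩ u v hu hv
    have hx14 := exit_bound hm h0 hp (T.par_lt k hk) hx
    exact (h.board_eq_of_exit hp hx hx14 (u' := -2) (v' := -4) (by omega) (by omega)
      (by omega)).trans (board_gadget_black hm h0 (by decide))
  exit_landing' x := by
    rintro ⟨m, hm, h0, hp, hx⟩ u v hu hv
    have hx14 := exit_bound hm h0 hp (T.par_lt k hk) hx
    exact (h.board_eq_of_exit hp hx hx14 (u' := -3) (v' := -5) (by omega) (by omega)
      (by omega)).trans (board_gadget_none hm h0 (by unfold Zone; omega) (by decide) (by omega)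
      (by omega) (by omega))
  exit_side' x := by
    rintro ⟨m, hm, h0, hp, hx⟩ u v hu hv
    have hx14 := exit_bound hm h0 hp (T.par_lt k hk) hx
    exact (h.board_eq_of_exit hp hx hx14 (u' := -2) (v' := -6) (by omega) (by omega)
      (by omega)).trans (board_gadget_none hm h0 (by unfold Zone; omega) (by decide) (by omega)
      (by omega) (by omega))
  exit_end x := by
    rintro ⟨m, hm, h0, hp, hx⟩ u v hu hv
    have hx14 := exit_bound hm h0 hp (T.par_lt k hk) hx
    refine ne_of_eq_of_ne ((h.board_eq_of_exit hp hx hx14 (u' := -5) (v' := -7) (by omega)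
      (by omega) (by omega)).trans (board_gadget_black hm h0 (by decide))) (by simp)

/-- The board after red has turned off towards the gadget of `m`. -/
theorem stage (hk : k ∈ T.node) (h : T.Ready k b) {m n : ℕ} (hm : m ∈ T.node) (h0 : m ≠ 0)
    (hp : T.par m = k) (hn : (2 * n : ℤ) = 16 * (m - T.par k) - 2) :
    T.Stage m (exitBoard b (sg k * (3 - 16 * (k - T.par k)), -3 - 16 * (k + T.par k)) (sg k) n)
      none (some redPawn) (some blackPawn) (some blackPawn) (some blackPawn) (some redPawn) := by
  set b' := exitBoard b (sg k * (3 - 16 * (k - T.par k)), -3 - 16 * (k + T.par k)) (sg k) n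
    with hb'
  have hx14 := exit_bound hm h0 hp (T.par_lt k hk) hn
  have hmk : m ≠ k := fun e => absurd (T.par_lt m hm h0) (by rw [hp, e]; exact lt_irrefl k)
  have hline : ∀ x y, b' (T.line k x y) = if x = 2 * n - 4 ∧ y = -(2 * n) - 4 then some redPawn
      else if x + y = 0 ∧ 0 ≤ x ∧ x ≤ 2 * n ∨ x = 2 * n - 1 ∧ y = -(2 * n) - 1 ∨
        x = 2 * n - 2 ∧ y = -(2 * n) - 2 ∨ x = 2 * n - 3 ∧ y = -(2 * n) - 3 then none
      else b (T.line k x y) := by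
    intro x y
    rw [← h.start]
    exact exitBoard_apply b _ (sg_eq k) n x y
  have hgad : ∀ x y, y ≤ -2 → x + y < 0 → b' (T.gadget m x y) =
      if x = -3 ∧ y = -5 then some redPawn
      else if x = 0 ∧ y = -2 ∨ x = -1 ∧ y = -3 ∨ x = -2 ∧ y = -4 then none
      else T.board (T.gadget m x y) := by
    intro x y hy hxy
    rw [gadget_line_of_exit hp hn, hline, h.below _ _ (by omega)]
    split_ifs <;> first | rfl | omega
  have hblack : ∀ x y, (x, y) ∈ blackSquares → y ≤ -2 → x + y < 0 → ¬ (x = 0 ∧ y = -2) →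
      ¬ (x = -2 ∧ y = -4) → b' (T.gadget m x y) = some blackPawn := by
    intro x y hq hy hxy h1 h2
    have h3 : ¬ (x = -3 ∧ y = -5) ∧ ¬ (x = -1 ∧ y = -3) := by
      constructor <;>
      · rintro ⟨rfl, rfl⟩
        revert hq
        decide
    rw [hgad x y hy hxy, if_neg h3.1, if_neg (by tauto), board_gadget_black hm h0 hq]
  -- The squares changed off the line of `k` all lie in the zone of `m`, which is disjoint from the
  -- other zones.
  have hfar : ∀ m' ∈ T.node, m' ≠ 0 → m' ≠ k → m' ≠ m → ∀ x y, Zone x y →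
      b' (T.gadget m' x y) = b (T.gadget m' x y) := by
    intro m' hm' h0' hk' hmm x y hz
    obtain ⟨u, v, huv⟩ := exists_line (T := T) k (T.gadget m' x y)
    have h1 : u + v ≠ 0 := fun h1 => gadget_ne_line hm' h0' hk' hz h1 huv
    have h2 : ∀ x' y', Zone x' y' → ¬ (u = 2 * n - 1 + x' ∧ v = -(2 * n - 1) + y') := by
      rintro x' y' hz' ⟨rfl, rfl⟩
      rw [← gadget_line_of_exit hp hn] at huv
      exact hmm (gadget_inj hm' h0' hm h0 hz hz' huv).1
    have h3 := h2 0 (-2) (by unfold Zone; norm_num)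
    have h4 := h2 (-1) (-3) (by unfold Zone; norm_num)
    have h5 := h2 (-2) (-4) (by unfold Zone; norm_num)
    have h6 := h2 (-3) (-5) (by unfold Zone; norm_num)
    rw [huv, hline, if_neg (by omega), if_neg (by omega)]
  constructor
  · exact (h.track hk).pawns_exitBoard n
  · refine HasFreePawn.congr_line (T := T) h.free k fun x y hy => ?_
    rw [hline, if_neg (by omega), if_neg (by omega)]
  · intro x y hy
    rw [gadget_line_of_exit hp hn, hline, if_neg (by omega), if_neg (by omega),
      h.below _ _ (by omega)]
  · rw [hgad _ _ (by norm_num) (by norm_num)]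
    simpa using board_eq_red (Or.inr ⟨m, hm, h0, Or.inr rfl⟩)
  · intro x y hq
    -- This pawn belongs to the line of `m`, where it has coordinate 3, and not to `blackSquares`.
    by_cases h66 : x = -6 ∧ y = -6
    · obtain ⟨rfl, rfl⟩ := h66
      rw [hgad _ _ (by norm_num) (by norm_num), if_neg (by norm_num), if_neg (by norm_num),
        gadget_eq_line hm h0]
      exact board_dot hm (by norm_num) (by norm_num) (by norm_num)
    · obtain ⟨h1, h2, h3, h4, h5⟩ := mem_blackSquares_of_ne _ hq (by simpa using h66)
      exact hblack x y h1 h2 h3 h4 h5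
  · intro x y hq
    simp only [List.mem_cons, Prod.mk.injEq, List.not_mem_nil, or_false] at hq
    rcases hq with ⟨rfl, rfl⟩ | ⟨rfl, rfl⟩ | ⟨rfl, rfl⟩
    · rw [hgad _ _ (by norm_num) (by norm_num)]
      simp
    · rw [hgad _ _ (by norm_num) (by norm_num), if_neg (by norm_num), if_neg (by norm_num)]
      exact board_gadget_none hm h0 (by unfold Zone; norm_num) (by decide) (by norm_num)
        (by norm_num) (by norm_num)
    · rw [hgad _ _ (by norm_num) (by norm_num), if_neg (by norm_num), if_neg (by norm_num)]
      exact board_gadget_none hm h0 (by unfold Zone; norm_num) (by decide) (by norm_num)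
        (by norm_num) (by norm_num)
  · rw [hgad _ _ (by norm_num) (by norm_num)]
    simp
  · rw [hgad _ _ (by norm_num) (by norm_num)]
    simp
  · exact hblack _ _ (by decide) (by norm_num) (by norm_num) (by norm_num) (by norm_num)
  · exact hblack _ _ (by decide) (by norm_num) (by norm_num) (by norm_num) (by norm_num)
  · exact hblack _ _ (by decide) (by norm_num) (by norm_num) (by norm_num) (by norm_num)
  · rw [hgad _ _ (by norm_num) (by norm_num)]
    simpa using board_eq_red (Or.inr ⟨m, hm, h0, Or.inl rfl⟩)
  · intro x y hr
    have hr' := hr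
    rw [gadget_line_of_exit hp hn, hline] at hr'
    split_ifs at hr' with h1 h2
    · left
      obtain rfl : x = -3 := by omega
      obtain rfl : y = -5 := by omega
      decide
    · rcases h.red _ _ hr' with h3 | ⟨m', hm', h0', hk', h3, h4⟩
      · omega
      · by_cases hmm : m' = m
        · subst hmm
          left
          rw [← gadget_line_of_exit hp hn] at h4
          simp only [gadget, place_inj (sg_eq _)] at h4
          rcases h4 with ⟨rfl, rfl⟩ | ⟨rfl, rfl⟩ <;> decide
        · right
          rw [← gadget_line_of_exit hp hn] at h4
          exact ⟨m', hm', h0', hmm, h3.congr (hfar m' hm' h0' hk' hmm), h4⟩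

end Ready

/-- With the plug gone, the pawn on (-3, -3) can jump over (-4, -4). A sideways first jump over (-2,
-4) is blocked by (-1, -5), and after one jump the vacated square (-4, -6) offers nothing to
capture. -/
theorem Stage.ready {m : ℕ} {b : Board} (hm : m ∈ T.node) (h0 : m ≠ 0)
    (h : T.Stage m b (some blackPawn) (some blackPawn) none none none none) : T.Ready m b := by
  have hline : ∀ x y, T.line m x y = T.gadget m (-(x + 3)) (y - 3) := by
    intro x y
    rw [gadget_eq_line hm h0]
    congr 1 <;> ring
  constructor
  · exact h.pawns
  · exact h.free
  · intro x y hy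
    rw [hline]
    exact h.below _ _ (by omega)
  · rw [hline]
    exact h.guard
  · rw [hline]
    exact h.black _ _ (by decide)
  · rw [hline]
    exact h.black _ _ (by decide)
  · rw [hline]
    exact h.eqV
  · rw [hline]
    exact h.empty _ _ (by decide)
  · rw [hline, hline]
    intro _
    exact gadget_ne_none (h.black (-1) (-5) (by decide)) (by norm_num) (by norm_num)
  · rw [hline]
    intro hb
    exact absurd (hb.symm.trans h.eqZ) (by simp)
  · intro x y hr
    rw [hline] at hr ⊢
    refine (h.red _ _ hr).imp_left fun hq => ?_
    simp only [List.mem_cons, Prod.mk.injEq, List.not_mem_nil, or_false] at hq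
    rcases hq with ⟨h1, h2⟩ | ⟨h1, h2⟩ | ⟨h1, h2⟩ | ⟨h1, h2⟩
    · exact absurd (hr.symm.trans (gadget_val h.eqX h1 h2)) (by simp)
    · exact absurd (hr.symm.trans (gadget_val h.eqZ h1 h2)) (by simp)
    · exact absurd (hr.symm.trans (gadget_val h.eqG h1 h2)) (by simp)
    · omega

/-- The root has no gadget, so its starting pawn on (3, -3) and its first black pawn on (4, -4) are
put on the board by hand. -/
theorem ready_board : T.Ready 0 T.board := by
  have hline : ∀ x y, T.line 0 x y = (3 + x, -3 + y) := by
    intro x y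
    simp [line, place, sg, T.par_zero]
  have hred : ∀ s : Square, 0 ≤ s.2 → ¬ T.IsRed s := by
    rintro s hs (rfl | ⟨m, hm, h0, rfl | rfl⟩)
    · norm_num at hs
    · exact absurd (snd_gadget_neg (T := T) h0 zone_guard.1) (not_lt.2 hs)
    · exact absurd (snd_gadget_neg (T := T) h0 zone_guard.2) (not_lt.2 hs)
  have hexit : ∀ x : ℤ, x < 14 → x ∉ T.exits 0 := by
    rintro x hx ⟨m, hm, h0, hp, h⟩
    exact absurd (exit_bound hm h0 hp (by simp) h) (not_le.2 hx)
  constructor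
  · exact T.pawnsOnly_board
  · refine ⟨board_eq_black (hred _ (by norm_num)) (Or.inl rfl),
      board_eq_none (hred _ (by norm_num)) ?_⟩
    rintro (h | h | ⟨k, hk, i, hi, hi', h⟩ | ⟨m, hm, h0, q, hq, h⟩)
    · norm_num at h
    · norm_num at h
    · exact absurd (snd_line_neg (T := T) k (x := i) (y := -i) (by omega))
        (by rw [← h]; norm_num)
    · exact absurd (snd_gadget_neg (T := T) h0 (zone_of_mem_blackSquares hq))
        (by rw [← h]; norm_num)
  · exact fun _ _ _ => rfl
  · exact board_eq_red (Or.inl (by rw [hline]; norm_num))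
  · exact board_eq_black (not_isRed_line T.zero_mem le_rfl)
      (Or.inr (Or.inl (by rw [hline]; norm_num)))
  · exact board_dot T.zero_mem (by norm_num) (by norm_num) (by norm_num)
  · exact board_landing T.zero_mem (by norm_num) (by simp) (by norm_num) (by norm_num)
  · exact board_landing T.zero_mem (by norm_num) (by simp) (by norm_num) (by norm_num)
  · exact board_side T.zero_mem (x := 0) (y := 0) rfl le_rfl (by simp)
      (hexit _ (by norm_num)) rfl
  · exact board_side T.zero_mem (x := 2) (y := -2) rfl (by norm_num) (by simp)
      (hexit _ (by norm_num)) rfl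
  · intro x y hr
    rcases isRed_of_board_eq hr with h | ⟨m, hm, h0, h⟩
    · left
      simp [hline] at h
      omega
    · exact Or.inr ⟨m, hm, h0, h0, intact_board hm h0, h⟩

end NatTree

/-! ### Lower bounds for the values by induction on labels -/

theorem not_legalMove_of_locked {p : Position} (hp : p.turn = .red) (hb : p.board.PawnsOnly)
    (h : ∀ s, p.board s = some redPawn → p.board.Locked s) (q : Position) : ¬ LegalMove p q := by
  have hjump : ∀ s d, ¬ p.board.CanJump .red s d := by
    intro s d hj
    exact (h s ((hb.canJump_red_iff _ _).1 hj).2.2.1).not_canJump hb d hj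
  rintro ⟨_, h1 | h1 | ⟨_, h1⟩⟩ <;> rw [hp] at h1
  · obtain ⟨s, t, h2, _⟩ := h1
    obtain ⟨_, ⟨d, hd, _⟩, _⟩ := (Relation.TransGen.head'_iff).1 h2
    exact hjump _ _ hd
  · obtain ⟨B, s, d, h0, h2, _⟩ := h1
    have h3 := (h2 0).1
    rw [h0] at h3
    exact hjump _ _ h3
  · obtain ⟨s, d, hs, _⟩ := h1
    obtain ⟨a, h2, h3, _⟩ := id hs
    rcases hb s with h4 | h4 | h4
    · rw [h4] at h2
      cases h2
    · rw [h4] at h2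
      cases h2
      cases h3
    · exact (h s h4).not_canStep d hs

namespace NatTree

variable {T : NatTree}

/-- Black has no jump and may therefore move the spare pawn from (0, 10) to (1, 11). This touches no
gadget, so all red pawns stay locked and Red has no reply. -/
theorem valueAtLeast_of_guarded {p : Position} {k : ℕ} (hp : p.turn = .black)
    (hb : p.board.PawnsOnly) (hfree : HasFreePawn p.board)
    (h : ∀ s, p.board s = some redPawn → T.Guarded p.board k s) :
    ValueAtLeast .black p 0 := by
  have hdark : ∀ s, p.board.step (0, 10) (1, 1) s ≠ none → s.IsDark := by
    intro s hs
    rw [Board.step_apply] at hs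
    split_ifs at hs with h1 h2
    · rw [h1]
      exact ⟨6, rfl⟩
    · exact absurd rfl hs
    · exact p.dark s hs
  have hmove : LegalMove p ⟨p.board.step (0, 10) (1, 1), .red, hdark⟩ := by
    refine ⟨by rw [hp]; rfl, Or.inr (Or.inr ⟨?_, (0, 10), (1, 1), ?_, rfl⟩)⟩
    · rw [hp]
      rintro ⟨s, d, hj⟩
      exact (h _ ((hb.canJump_black_iff _ _).1 hj).2.2.2.1).locked.not_captured hb hj
    · rw [hp]
      exact ⟨blackPawn, hfree.1, rfl, ⟨Or.inl rfl, Or.inl rfl, fun _ => rfl⟩, hfree.2⟩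
  refine ValueAtLeast.of_turn_self_zero hp hmove
    (ValueAtLeast.of_turn_other rfl (fun r hr => ?_) (fun β hβ => absurd hβ not_lt_bot))
  refine absurd hr (not_legalMove_of_locked rfl ?_ ?_ r)
  · intro s
    simp only [Board.step_apply]
    split_ifs
    · exact hb _
    · exact Or.inl rfl
    · exact hb s
  · intro s hs
    have hs' := hs
    simp only [Board.step_apply] at hs'
    split_ifs at hs' with h1 h2
    · exact absurd (hs'.symm.trans hfree.1) (by simp)
    · obtain ⟨m, hm, h0, hmk, h3, h4⟩ := h s hs'
      refine Guarded.locked (T := T) (k := k) ⟨m, hm, h0, hmk, h3.congr fun x y hz => ?_, h4⟩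
      have hneg := snd_gadget_neg (T := T) h0 hz
      dsimp only
      rw [Board.step_apply, if_neg, if_neg]
      · intro h5
        rw [h5] at hneg
        norm_num at hneg
      · intro h5
        rw [h5] at hneg
        norm_num at hneg

theorem gadget_add (m : ℕ) (x y ε δ : ℤ) :
    T.gadget m x y + (sg (T.par m) * ε, δ) = T.gadget m (x + ε) (y + δ) :=
  place_add _ _ _ _ _ _

theorem Stage.valueAtLeast {m : ℕ} {α : Ordinal.{0}} (hm : m ∈ T.node) (h0 : m ≠ 0)
    (hα : ∀ p : Position, p.turn = .red → T.Ready m p.board → ValueAtLeast .black p α)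
    {p : Position} (hp : p.turn = .black) (h : T.Stage m p.board none (some redPawn)
      (some blackPawn) (some blackPawn) (some blackPawn) (some redPawn)) :
    ValueAtLeast .black p (α + 1) := by
  have third : ∀ p : Position, p.turn = .black → T.Stage m p.board (some blackPawn) none
      (some redPawn) (some blackPawn) none none → ValueAtLeast .black p α := by
    intro p hp h
    have hj := h.canJump_recapture
    have hu := h.eq_of_canJump_recapture
    have hs : ∀ d, ¬ (p.board.jump (T.gadget m (-5) (-7)) (sg (T.par m) * 1, 1)).CanJump .black
        (T.gadget m (-5) (-7) + (sg (T.par m) * 1, 1) + (sg (T.par m) * 1, 1)) d := by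
      rw [gadget_add, gadget_add]
      exact (h.recapture hm h0).not_canJump_recapture
    rw [← hp] at hj hu hs
    obtain ⟨q, hq, _⟩ := exists_legalMove_of_canJump hj hs
    -- Black's second capture raises the bound once more, but only one increment per gadget is
    -- needed.
    refine (ValueAtLeast.of_turn_self hp hq fun r hr => hα r ?_ ?_).mono (lt_add_one α).le
    · rw [hr.1, hp]
      rfl
    · rw [hr.eq_jump hj hu hs]
      exact (h.recapture hm h0).ready hm h0
  have second : ∀ p : Position, p.turn = .red → T.Stage m p.board (some blackPawn) none
      none (some blackPawn) (some blackPawn) (some redPawn) → ValueAtLeast .black p α := by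
    intro p hp h
    have hj := h.canJump_release
    have hu := h.eq_of_canJump_release
    have hs : ∀ d, ¬ (p.board.jump (T.gadget m (-6) (-4)) (sg (T.par m) * 1, -1)).CanJump .red
        (T.gadget m (-6) (-4) + (sg (T.par m) * 1, -1) + (sg (T.par m) * 1, -1)) d := by
      rw [gadget_add, gadget_add]
      exact (h.release hm h0).not_canJump_release
    rw [← hp] at hj hu hs
    obtain ⟨q, hq, _⟩ := exists_legalMove_of_canJump hj hs
    refine ValueAtLeast.of_turn_other_of_forall hp hq fun r hr => third r ?_ ?_
    · rw [hr.1, hp]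
      rfl
    · rw [hr.eq_jump hj hu hs]
      exact h.release hm h0
  have hj := h.canJump_capture
  have hu := h.eq_of_canJump_capture
  have hs : ∀ d, ¬ (p.board.jump (T.gadget m (-4) (-6)) (sg (T.par m) * 1, 1)).CanJump .black
      (T.gadget m (-4) (-6) + (sg (T.par m) * 1, 1) + (sg (T.par m) * 1, 1)) d := by
    rw [gadget_add, gadget_add]
    exact (h.capture hm h0).not_canJump_capture
  rw [← hp] at hj hu hs
  obtain ⟨q, hq, _⟩ := exists_legalMove_of_canJump hj hs
  refine ValueAtLeast.of_turn_self hp hq fun r hr => second r ?_ ?_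
  · rw [hr.1, hp]
    rfl
  · rw [hr.eq_jump hj hu hs]
    exact h.capture hm h0

/-- If red decides to jump along the line of `k` forever, then black wins. -/
theorem Ready.valueAtLeast_of_infinite {k : ℕ} {p q : Position} (h : T.Ready k p.board)
    (hq : q.turn = .black) (hb : ∀ x y, q.board (T.line k x y) =
      if x + y = 0 ∧ 0 ≤ x ∧ (x = 0 ∨ x % 2 = 1) then none else p.board (T.line k x y)) :
    ValueAtLeast .black q 0 := by
  refine valueAtLeast_of_guarded (T := T) (k := k) hq ?_ ?_ ?_
  · intro s
    obtain ⟨x, y, rfl⟩ := exists_line (T := T) k s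
    rw [hb]
    split_ifs
    · exact Or.inl rfl
    · exact h.pawns _
  · refine HasFreePawn.congr_line (T := T) h.free k fun x y hy => ?_
    rw [hb, if_neg (by omega)]
  · intro s hs
    obtain ⟨x, y, rfl⟩ := exists_line (T := T) k s
    rw [hb] at hs
    split_ifs at hs with hxy
    obtain h1 | ⟨m, hm, h0, hmk, h1, h2⟩ := h.red x y hs
    · omega
    · refine ⟨m, hm, h0, hmk, h1.congr fun u v hz => ?_, h2⟩
      obtain ⟨a, c, hac⟩ := exists_line (T := T) k (T.gadget m u v)
      rw [hac, hb, if_neg]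
      exact fun h3 => gadget_ne_line hm h0 hmk hz h3.1 hac

/-- Labels drop along the tree, so the recursion is well founded and a value exists. Every `β < lab
k` labels a child, whose gadget costs Black a move, and the supremum of the ordinals `β + 1` is `lab
k`. -/
theorem valueAtLeast_of_ready (lab : ℕ → Ordinal.{0})
    (hlab : ∀ m ∈ T.node, m ≠ 0 → lab m < lab (T.par m))
    (hchild : ∀ k ∈ T.node, ∀ β < lab k, ∃ m ∈ T.node, m ≠ 0 ∧ T.par m = k ∧ lab m = β)
    (α : Ordinal.{0}) : ∀ k ∈ T.node, lab k = α → ∀ p : Position, p.turn = .red →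
      T.Ready k p.board → ValueAtLeast .black p α := by
  induction α using WellFoundedLT.induction with
  | ind α ih =>
    rintro k hk rfl p hp h
    have hstage : ∀ q : Position, q.turn = .black → ∀ m ∈ T.node, m ≠ 0 → T.par m = k → ∀ n : ℕ,
        (2 * n : ℤ) = 16 * (m - T.par k) - 2 → q.board = exitBoard p.board
          (sg k * (3 - 16 * (k - T.par k)), -3 - 16 * (k + T.par k)) (sg k) n →
        ValueAtLeast .black q (lab m + 1) := by
      intro q hq m hm h0 hpm n hn hqn
      refine Stage.valueAtLeast hm h0 (ih (lab m) (hpm ▸ hlab m hm h0) m hm rfl) hq ?_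
      rw [hqn]
      exact h.stage hk hm h0 hpm hn
    refine ValueAtLeast.of_turn_other hp (fun r hr => ?_) (fun β hβ => ?_)
    · have hrt : r.turn = .black := by
        rw [hr.1, hp]
        rfl
      rcases (h.track hk).of_legalMove hp hr with ⟨n, ⟨m, hm, h0, hpm, hn⟩, hrn⟩ | hinf
      · exact (hstage r hrt m hm h0 hpm n hn hrn).mono bot_le
      · exact h.valueAtLeast_of_infinite hrt hinf
    · obtain ⟨m, hm, h0, hpm, rfl⟩ := hchild k hk β hβ
      have hb := exit_bound hm h0 hpm (T.par_lt k hk) rfl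
      -- Each jump advances by 2, so half the coordinate of the turn-off counts the jumps before it.
      have hn : (2 * ((8 * (m - T.par k) - 1 : ℤ).toNat : ℕ) : ℤ) = 16 * (m - T.par k) - 2 := by
        omega
      obtain ⟨q, hq, hqn⟩ := (h.track hk).exists_legalMove hp ⟨m, hm, h0, hpm, hn⟩
      refine ⟨q, hq, hstage q ?_ m hm h0 hpm _ hn hqn⟩
      rw [hq.1, hp]
      rfl

theorem isDark_place {o : Square} {σ x y : ℤ} (hσ : σ = 1 ∨ σ = -1) (ho : Even (o.1 + o.2))
    (h : Even (x + y)) : (place o σ x y).IsDark := by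
  unfold Square.IsDark place
  obtain ⟨a, ha⟩ := ho
  obtain ⟨c, hc⟩ := h
  rcases hσ with rfl | rfl
  · exact ⟨a + c, by dsimp only; omega⟩
  · exact ⟨a + c - x, by dsimp only; omega⟩

theorem isDark_gadget (m : ℕ) {x y : ℤ} (h : Even (x + y)) : (T.gadget m x y).IsDark := by
  refine isDark_place (sg_eq _) ?_ h
  rcases sg_eq (T.par m) with hs | hs <;> rw [hs, Int.even_iff] <;> dsimp only <;> omega

theorem isDark_line (k : ℕ) {x y : ℤ} (h : Even (x + y)) : (T.line k x y).IsDark := by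
  refine isDark_place (sg_eq _) ?_ h
  rcases sg_eq k with hs | hs <;> rw [hs, Int.even_iff] <;> dsimp only <;> omega

theorem isDark_of_board_ne_none (s : Square) (hs : T.board s ≠ none) : s.IsDark := by
  by_cases h1 : T.IsRed s
  · rcases h1 with rfl | ⟨m, hm, h0, rfl | rfl⟩
    · exact ⟨0, rfl⟩
    · exact isDark_gadget m (by decide)
    · exact isDark_gadget m (by decide)
  · by_cases h2 : T.IsBlack s
    · rcases h2 with rfl | rfl | ⟨k, hk, i, hi, hi', rfl⟩ | ⟨m, hm, h0, q, hq, rfl⟩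
      · exact ⟨5, rfl⟩
      · exact ⟨0, rfl⟩
      · exact isDark_line k (by simp)
      · refine isDark_gadget m ?_
        clear hs h1
        revert q
        decide
    · exact absurd (board_eq_none h1 h2) hs

end NatTree

/-! ### The tree of descending sequences below a countable ordinal -/

/-- The parent of a number, in the tree in which each number `k` has infinitely many children. -/
def parent (m : ℕ) : ℕ := (Nat.unpair ((m - 1) / 2)).2

theorem parent_lt {m : ℕ} (h : m ≠ 0) : parent m < m := by
  have := Nat.unpair_right_le ((m - 1) / 2)
  unfold parent
  omega

/-- The label of a number. -/
noncomputable def label (α : Ordinal.{0}) (f : ℕ → Ordinal.{0}) (m : ℕ) : Ordinal.{0} :=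
  if m = 0 then α else f (Nat.unpair ((m - 1) / 2)).1

/-- The numbers for which the labels decrease on the way from the root. -/
inductive IsNode (α : Ordinal.{0}) (f : ℕ → Ordinal.{0}) : ℕ → Prop
  | zero : IsNode α f 0
  | child (m : ℕ) : m ≠ 0 → IsNode α f (parent m) → (m + parent m) % 2 = 1 →
      label α f m < label α f (parent m) → IsNode α f m

theorem IsNode.of_ne_zero {α : Ordinal.{0}} {f : ℕ → Ordinal.{0}} {m : ℕ} (h : IsNode α f m)
    (h0 : m ≠ 0) : (m + parent m) % 2 = 1 ∧ label α f m < label α f (parent m) := by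
  cases h with
  | zero => exact absurd rfl h0
  | child _ _ _ h1 h2 => exact ⟨h1, h2⟩

theorem IsNode.label_le {α : Ordinal.{0}} {f : ℕ → Ordinal.{0}} {m : ℕ} (h : IsNode α f m) :
    label α f m ≤ α := by
  induction h with
  | zero => exact le_rfl
  | child m _ _ _ h ih => exact h.le.trans ih

/-- The tree of the descending sequences of labels. -/
def descentTree (α : Ordinal.{0}) (f : ℕ → Ordinal.{0}) : NatTree where
  par := parent
  node := {m | IsNode α f m}
  zero_mem := IsNode.zero
  par_zero := rfl
  par_lt _ _ h0 := parent_lt h0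
  parity _ hm h0 := (IsNode.of_ne_zero hm h0).1

theorem exists_child {α : Ordinal.{0}} {f : ℕ → Ordinal.{0}} (hf : Set.Iio α ⊆ Set.range f) {k : ℕ}
    (hk : IsNode α f k) {β : Ordinal.{0}} (hβ : β < label α f k) :
    ∃ m, IsNode α f m ∧ m ≠ 0 ∧ parent m = k ∧ label α f m = β := by
  obtain ⟨n, rfl⟩ := hf (hβ.trans_le hk.label_le)
  -- The pair `(n, k)` encodes a child of `k` with label `f n`; adding `1 + k % 2` gives it the
  -- parity opposite to `k` without affecting the decoding.
  have h0 : 2 * Nat.pair n k + 1 + k % 2 ≠ 0 := by omega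
  have hdiv : (2 * Nat.pair n k + 1 + k % 2 - 1) / 2 = Nat.pair n k := by omega
  have hpar : parent (2 * Nat.pair n k + 1 + k % 2) = k := by
    rw [parent, hdiv, Nat.unpair_pair]
  have hlab : label α f (2 * Nat.pair n k + 1 + k % 2) = f n := by
    rw [label, if_neg h0, hdiv, Nat.unpair_pair]
  refine ⟨_, IsNode.child _ h0 (by rwa [hpar]) ?_ (by rwa [hpar, hlab]), h0, hpar, hlab⟩
  rw [hpar]
  omega

theorem exists_valueAtLeast_black {α : Ordinal.{0}} (hα : (Set.Iio α).Countable) :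
    ∃ p, ValueAtLeast .black p α := by
  obtain ⟨f, hf⟩ := Set.countable_iff_exists_subset_range.1 hα
  let T := descentTree α f
  refine ⟨⟨T.board, .red, NatTree.isDark_of_board_ne_none⟩, ?_⟩
  refine NatTree.valueAtLeast_of_ready (T := T) (label α f)
    (fun m hm h0 => (IsNode.of_ne_zero hm h0).2)
    (fun k hk β hβ => exists_child hf hk hβ) α 0 T.zero_mem rfl _ rfl NatTree.ready_board

end Draughts

/-! ### Both players and all countable ordinals -/

theorem theorem1 (o : Draughts.Player) :
    (∀ α : Ordinal.{0}, α.card ≤ Cardinal.aleph0 →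
      ∃ p : Draughts.Position, Draughts.HasGameValue o p α) ∧
    (∀ p : Draughts.Position,
      (∀ q, Relation.ReflTransGen Draughts.LegalMove p q →
        {r | Draughts.LegalMove q r}.Countable) →
      ∀ α : Ordinal.{0}, Draughts.HasGameValue o p α → α.card ≤ Cardinal.aleph0) := by
  refine ⟨fun α hα => ?_, fun p hp α h => ?_⟩
  · rw [Draughts.card_le_aleph0_iff] at hα
    obtain ⟨p, β, hβ, hv⟩ := Draughts.exists_valueAtLeast_black hα
    cases o with
    | black => exact hv.exists_of_le β p α hβ
    | red => exact (hv.flip β _ p).exists_of_le β _ α hβ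
  · rw [Draughts.card_le_aleph0_iff]
    exact h.countable α p hp
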